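/- A temporal graph $\mathcal{G}=\langle G_1,\dots,G_L\rangle$ is a sequence of $L$ (simple, undirected) graphs, its snapshots, on a common finite vertex set; $L$ is its lifetime, and its underlying graph contains the edges that appear in at least one snapshot. A temporal walk from $v$ to $u$ is a sequence of vertices $v=v_0,v_1,\dots,v_\ell=u$ together with time steps $1\le t_1<\dots<t_\ell\le L$ such that $\{v_{i-1},v_i\}$ is an edge of $G_{t_i}$ for every $i$. An exploration schedule of $\mathcal{G}$ from $v$ is a temporal walk that starts at $v$ and visits all vertices; if there is one, $\mathcal{G}$ can be explored from $v$. $\mathcal{G}$ is $\Delta$-temporally connected if for any $\Delta$ consecutive time steps and any ordered pair of vertices $(v,u)$ there is a temporal walk from $v$ to $u$ that uses only these time steps. $\mathcal{G}$ is $k$-edge-deficient if its underlying graph has a spanning tree $T$ such that every snapshot contains all but at most $k$ edges of $T$. Theorem. Let $\Delta$, $k$, $n$ be natural numbers with $k\ge 1$, and let $\mathcal{G}$ be a $\Delta$-temporally connected $k$-edge-deficient temporal graph on $n$ vertices whose lifetime $L$ satisfies $$L \;\ge\; 2\,\lceil 36k\ln(12k)\rceil\Bigl(\Delta+\frac{n}{2k}\Bigr).$$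 Then $\mathcal{G}$ can be explored from any vertex. Moreover: (a) there is a Las Vegas algorithm that, given any such $\mathcal{G}$ (for any $\Delta$, $k$, $n$) and a vertex $v$, computes an exploration schedule of $\mathcal{G}$ from $v$: whenever it halts its output is correct, and its expected running time is at most a polynomial in $n+L$ (the polynomial does not depend on $k$ and $\Delta$); (b) there is a deterministic algorithm that, given any such $\mathcal{G}$ and $v$, computes an exploration schedule of $\mathcal{G}$ from $v$, and whose running time is, for every fixed $k$, at most a polynomial (which may depend on $k$) in $n+L$. -/

import Mathlib

open MeasureTheory
open scoped ENNReal

namespace TemporalExploration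

/-! ## Temporal graphs -/

/-- A temporal graph with vertex set `V` and lifetime `L`: a sequence of `L` snapshots, which are
simple graphs on `V`. Time steps are numbered `0, …, L - 1`. -/
abbrev TemporalGraph (V : Type*) (L : ℕ) := Fin L → SimpleGraph V

namespace TemporalGraph

variable {V : Type*} {L : ℕ}

/-- The underlying graph: its edges are the edges that appear in at least one snapshot. -/
def underlying (G : TemporalGraph V L) : SimpleGraph V where
  Adj u v := ∃ t, (G t).Adj u v
  symm := ⟨fun _ _ ⟨t, h⟩ => ⟨t, h.symm⟩⟩
  loopless := ⟨fun _ ⟨_, h⟩ => h.ne rfl⟩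

/-- The restriction of `G` to the `d` consecutive time steps `s, s + 1, …, s + d - 1`. -/
def window (G : TemporalGraph V L) (s d : ℕ) (h : s + d ≤ L) : TemporalGraph V d :=
  fun i => G ⟨s + i, by omega⟩

/-- `G.IsWalk v w` says that the list of moves `w = [(t₁, v₁), …, (t_ℓ, v_ℓ)]` is a temporal walk
starting at `v`: with `v₀ = v`, the pair `{v_{i-1}, v_i}` is an edge of snapshot `t_i`, and
`t₁ < t₂ < ⋯ < t_ℓ`. The length of the walk is the length of the list. -/
def IsWalk (G : TemporalGraph V L) : V → List (Fin L × V) → Prop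
  | _, [] => True
  | v, (t, u) :: w => (G t).Adj v u ∧ (∀ m ∈ w, t < m.1) ∧ IsWalk G u w

/-- The last vertex of the walk that starts at `v` and makes the moves `w`. -/
def walkEnd : V → List (Fin L × V) → V
  | v, [] => v
  | _, (_, u) :: w => walkEnd u w

/-- `G` is temporally connected: every vertex reaches every vertex by a temporal walk. -/
def TemporallyConnected (G : TemporalGraph V L) : Prop :=
  ∀ v u : V, ∃ w : List (Fin L × V), G.IsWalk v w ∧ walkEnd v w = u

/-- `G` is `Δ`-temporally connected: every restriction of `G` to `Δ` consecutive time steps is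
temporally connected. -/
def DeltaTemporallyConnected (G : TemporalGraph V L) (Δ : ℕ) : Prop :=
  ∀ (s : ℕ) (h : s + Δ ≤ L), (G.window s Δ h).TemporallyConnected

/-- `T` is a spanning tree of the graph `H` (on the same vertex set). -/
def IsSpanningTree (T H : SimpleGraph V) : Prop := T ≤ H ∧ T.IsTree

/-- All but at most `k` edges of `F` are present in the snapshot `S`. -/
def SnapshotDeficient (k : ℕ) (F S : SimpleGraph V) : Prop :=
  (F.edgeSet \ S.edgeSet).encard ≤ k

/-- `G` is `k`-edge-deficient: for some spanning tree of the underlying graph, every snapshot is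
`k`-edge-deficient with respect to that tree. -/
def EdgeDeficient (G : TemporalGraph V L) (k : ℕ) : Prop :=
  ∃ T : SimpleGraph V, IsSpanningTree T G.underlying ∧ ∀ t, SnapshotDeficient k T (G t)

/-- `w` is an exploration schedule of `G` from `v`: a temporal walk that starts at `v` and visits
all vertices. -/
def IsExploration (G : TemporalGraph V L) (v : V) (w : List (Fin L × V)) : Prop :=
  G.IsWalk v w ∧ ∀ u : V, u ∈ v :: w.map Prod.snd

/-- `G` can be explored from `v` in at most `ℓ` steps. -/
def ExplorableInFrom (G : TemporalGraph V L) (ℓ : ℕ) (v : V) : Prop :=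
  ∃ w : List (Fin L × V), w.length ≤ ℓ ∧ G.IsExploration v w

/-- `G` can be explored from `v` (within its lifetime). -/
def ExplorableFrom (G : TemporalGraph V L) (v : V) : Prop := G.ExplorableInFrom L v

/-- The hypotheses on a temporal graph with finite vertex set: `k ≥ 1`, `G` is `Δ`-temporally
connected and `k`-edge-deficient, and its lifetime `L` is at least
`2 ⌈36 k ln (12 k)⌉ (Δ + n / (2 k))`, where `n` is the number of vertices. -/
def LongStable [Fintype V] (G : TemporalGraph V L) (Δ k : ℕ) : Prop :=
  1 ≤ k ∧ G.DeltaTemporallyConnected Δ ∧ G.EdgeDeficient k ∧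
    2 * (⌈36 * (k : ℝ) * Real.log (12 * (k : ℝ))⌉₊ : ℝ) *
      ((Δ : ℝ) + (Fintype.card V : ℝ) / (2 * (k : ℝ))) ≤ (L : ℝ)

end TemporalGraph

/-! ## The machine model: WHILE programs over binary trees, with fair coin flips

All data are binary trees, stored as pointers to immutable cells. A program has finitely many
variables, and its elementary operations (read a variable, allocate a cell, follow a pointer,
test for `nil`, write a variable, flip a fair coin) are charged one step each. -/

/-- The data: finite binary trees with unlabelled leaves. -/
inductive BTree : Type
  | nil : BTree
  | cons : BTree → BTree → BTree

namespace BTree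

/-- Left child (`nil` for a leaf). -/
def hd : BTree → BTree
  | nil => nil
  | cons a _ => a

/-- Right child (`nil` for a leaf). -/
def tl : BTree → BTree
  | nil => nil
  | cons _ b => b

/-- Truth values: `false` is the leaf, `true` is a non-leaf. -/
def ofBool : Bool → BTree
  | false => nil
  | true => cons nil nil

/-- Natural numbers in unary. -/
def ofNat : ℕ → BTree
  | 0 => nil
  | n + 1 => cons nil (ofNat n)

/-- Lists of trees as right-nested pairs. -/
def ofList : List BTree → BTree
  | [] => nil
  | a :: l => cons a (ofList l)

end BTree

/-- The contents of the variables `X₀, X₁, …`; every program uses finitely many of them. -/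
abbrev Store := ℕ → BTree

/-- Expressions. -/
inductive Expr : Type
  | nil : Expr
  | var : ℕ → Expr
  | cons : Expr → Expr → Expr
  | hd : Expr → Expr
  | tl : Expr → Expr

namespace Expr

/-- The value of an expression. -/
def eval (σ : Store) : Expr → BTree
  | nil => BTree.nil
  | var x => σ x
  | cons a b => BTree.cons (a.eval σ) (b.eval σ)
  | hd a => (a.eval σ).hd
  | tl a => (a.eval σ).tl

/-- The number of steps that evaluating an expression takes: one for each operation in it. -/
def cost : Expr → ℕ
  | nil => 1
  | var _ => 1
  | cons a b => a.cost + b.cost + 1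
  | hd a => a.cost + 1
  | tl a => a.cost + 1

end Expr

/-- Programs. `flip x` assigns the result of a fair coin flip to `X_x`; conditions hold when they
evaluate to a non-leaf. -/
inductive Prog : Type
  | assign : ℕ → Expr → Prog
  | flip : ℕ → Prog
  | seq : Prog → Prog → Prog
  | ite : Expr → Prog → Prog → Prog
  | loop : Expr → Prog → Prog

/-- A program is deterministic if it contains no coin flip. -/
def Prog.Deterministic : Prog → Prop
  | .assign _ _ => True
  | .flip _ => False
  | .seq p q => p.Deterministic ∧ q.Deterministic
  | .ite _ p q => p.Deterministic ∧ q.Deterministic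
  | .loop _ p => p.Deterministic

/-- Infinite sequences of coin results. -/
abbrev Coins := ℕ → Bool

/-- `Exec p s s' m`: started with variables `s.1` and with `s.2` as the results of the coming coin
flips, the program `p` halts after exactly `m` steps with variables `s'.1`, the unused coin
results being `s'.2`. -/
inductive Exec : Prog → Store × Coins → Store × Coins → ℕ → Prop
  | assign (x : ℕ) (e : Expr) (σ : Store) (ω : Coins) :
      Exec (.assign x e) (σ, ω) (Function.update σ x (e.eval σ), ω) (e.cost + 1)
  | flip (x : ℕ) (σ : Store) (ω : Coins) :
      Exec (.flip x) (σ, ω)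
        (Function.update σ x (BTree.ofBool (ω 0)), fun i => ω (i + 1)) 1
  | seq {p q : Prog} {s s' s'' : Store × Coins} {m m' : ℕ} :
      Exec p s s' m → Exec q s' s'' m' → Exec (.seq p q) s s'' (m + m')
  | ite_true {e : Expr} {p q : Prog} {s s' : Store × Coins} {m : ℕ} :
      e.eval s.1 ≠ BTree.nil → Exec p s s' m → Exec (.ite e p q) s s' (e.cost + 1 + m)
  | ite_false {e : Expr} {p q : Prog} {s s' : Store × Coins} {m : ℕ} :
      e.eval s.1 = BTree.nil → Exec q s s' m → Exec (.ite e p q) s s' (e.cost + 1 + m)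
  | loop_true {e : Expr} {p : Prog} {s s' s'' : Store × Coins} {m m' : ℕ} :
      e.eval s.1 ≠ BTree.nil → Exec p s s' m → Exec (.loop e p) s' s'' m' →
        Exec (.loop e p) s s'' (e.cost + 1 + m + m')
  | loop_false {e : Expr} {p : Prog} {s : Store × Coins} :
      e.eval s.1 = BTree.nil → Exec (.loop e p) s s (e.cost + 1)

/-- On input `a` (in variable `X₀`, all others being `nil`) and coin sequence `ω`, the program `p`
halts after exactly `m` steps with output `b` (in variable `X₀`). -/
def Prog.Outputs (p : Prog) (a : BTree) (ω : Coins) (b : BTree) (m : ℕ) : Prop :=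
  ∃ s' : Store × Coins,
    Exec p (Function.update (fun _ => BTree.nil) 0 a, ω) s' m ∧ s'.1 0 = b

/-- A run is determined by the program, the initial store and the coin sequence. -/
theorem Exec.unique {p : Prog} {s s₁ s₂ : Store × Coins} {m₁ m₂ : ℕ}
    (h₁ : Exec p s s₁ m₁) (h₂ : Exec p s s₂ m₂) : s₁ = s₂ ∧ m₁ = m₂ := by
  induction h₁ generalizing s₂ m₂ with
  | assign => cases h₂; exact ⟨rfl, rfl⟩
  | flip => cases h₂; exact ⟨rfl, rfl⟩
  | seq _ _ ih ih' =>
    cases h₂ with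
    | seq a b =>
      obtain ⟨rfl, rfl⟩ := ih a
      obtain ⟨rfl, rfl⟩ := ih' b
      exact ⟨rfl, rfl⟩
  | ite_true h _ ih =>
    cases h₂ with
    | ite_true _ a => obtain ⟨rfl, rfl⟩ := ih a; exact ⟨rfl, rfl⟩
    | ite_false h' _ => exact absurd h' h
  | ite_false h _ ih =>
    cases h₂ with
    | ite_true h' _ => exact absurd h h'
    | ite_false _ a => obtain ⟨rfl, rfl⟩ := ih a; exact ⟨rfl, rfl⟩
  | loop_true h _ _ ih ih' =>
    cases h₂ with
    | loop_true _ a b =>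
      obtain ⟨rfl, rfl⟩ := ih a
      obtain ⟨rfl, rfl⟩ := ih' b
      exact ⟨rfl, rfl⟩
    | loop_false h' => exact absurd h' h
  | loop_false h =>
    cases h₂ with
    | loop_true h' _ _ => exact absurd h h'
    | loop_false _ => exact ⟨rfl, rfl⟩

/-- The running time on input `a` with coin sequence `ω`; it is `∞` if the run does not halt. -/
noncomputable def Prog.runTime (p : Prog) (a : BTree) (ω : Coins) : ℝ≥0∞ :=
  ⨅ (m : ℕ) (_ : ∃ b, p.Outputs a ω b m), (m : ℝ≥0∞)

/-- The law of a sequence of independent fair coin flips. -/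
noncomputable def coinMeasure : Measure Coins :=
  Measure.infinitePi fun _ : ℕ => (PMF.uniformOfFintype Bool).toMeasure

/-- The expected running time on input `a`. -/
noncomputable def Prog.expectedTime (p : Prog) (a : BTree) : ℝ≥0∞ :=
  ∫⁻ ω, p.runTime a ω ∂coinMeasure

/-! ## Encoding of the input and the output -/

open Classical in
/-- The algorithmic input: the number `n` of vertices, the start vertex, and the sequence of the
adjacency matrices of the snapshots. -/
noncomputable def encodeInput {n L : ℕ} (G : TemporalGraph (Fin n) L) (v : Fin n) : BTree :=
  .cons (.ofNat n) (.cons (.ofNat v)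
    (.ofList (List.ofFn fun t : Fin L =>
      .ofList (List.ofFn fun x : Fin n =>
        .ofList (List.ofFn fun y : Fin n => .ofBool (decide ((G t).Adj x y)))))))

/-- The algorithmic output: the list of the moves (time step, new vertex) of a temporal walk. -/
def encodeWalk {n L : ℕ} (w : List (Fin L × Fin n)) : BTree :=
  .ofList (w.map fun m => .cons (.ofNat m.1) (.ofNat m.2))

/-- `b` is the encoding of an exploration schedule of `G` from `v`. -/
def IsScheduleCode {n L : ℕ} (G : TemporalGraph (Fin n) L) (v : Fin n) (b : BTree) : Prop :=
  ∃ w : List (Fin L × Fin n), b = encodeWalk w ∧ G.IsExploration v w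

end TemporalExploration

open TemporalExploration

namespace TemporalExploration

/-! A single deterministic polynomial-time algorithm proves everything; no randomness is needed.
Time is cut into phases of two intervals of `D` steps. With `D ≥ Δ`, the first interval of a phase
suffices to move to any prescribed vertex. In the second interval the agent follows a piece of one
fixed closed tour, waiting whenever the next edge is missing.

The tour runs along a minimum spanning tree, an edge being weighted by the number of snapshots of
the second intervals that miss it. If there are `r` phases, these intervals contain `r * D`
snapshots, each missing at most `k` edges of the tree from edge-deficiency. That tree therefore has
weight at most `k * r * D`, and the minimality of Prim's tree (`Joins.exchange`, `TourInv.extend`)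
bounds the misses along the tour by `2 * k * r * D` (`tourFrom_spec`).

Pieces are assigned greedily: the rest of the tour goes to the free phase in which an agent gets
farthest. Suppose that something is left after `j` choices. A phase that is still free was never
strictly better than the phase chosen, so even `j` repetitions of it would not have exhausted the
tour (`GreedyInv`). In each repetition all `D` steps are spent either on advancing or on waiting for
an edge that is then left behind, so the number of vertices of the tour plus its misses in that
phase is at least `j * D` (`potential_run`). Summing over the at least `r - j` free phases gives `(r
- j) * j * D`. But the sum over all phases is less than `4 * k * r * D + 2 * k * r * D` as soon as
`n ≤ 2 * k * D`. For `j = r / 2` and `r ≥ 24 * k + 2` this is a contradiction (`greedy_fst_eq_nil`,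
`visitsAll_plan`).

The assumed lifetime leaves room for that many phases with `D` the maximum of `Δ` and `n / (2 * k)`
rounded up. Since `Δ` and `k` are not part of the input, all values of `D` are tried; every plan is
a temporal walk, and whether it visits all vertices can be checked.

The running time is handled by the class `PT` of functions computed by WHILE programs in polynomial
time. It is closed under composition, pairing, branching and those folds whose intermediate results
stay polynomially small, and the algorithm is written with these operations only. -/

/-! ## Typed data and polynomial-time functions -/

/-- Types whose elements are represented by binary trees. -/
class Enc (α : Type) where
  /-- The representing tree. -/
  enc : α → BTree

open Enc

/-- The number of nodes and leaves of a tree. -/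
def BTree.size : BTree → ℕ
  | .nil => 1
  | .cons a b => a.size + b.size + 1

/-- The size of the tree that represents `a`. -/
def sz {α : Type} [Enc α] (a : α) : ℕ := (enc a).size

instance : Enc Unit := ⟨fun _ => .nil⟩
instance : Enc Bool := ⟨BTree.ofBool⟩
instance : Enc ℕ := ⟨BTree.ofNat⟩
instance {α : Type} [Enc α] : Enc (List α) := ⟨fun l => .ofList (l.map enc)⟩
instance {α β : Type} [Enc α] [Enc β] : Enc (α × β) := ⟨fun p => .cons (enc p.1) (enc p.2)⟩

/-! ### Sizes of encodings. -/

section Size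

variable {α β : Type} [Enc α] [Enc β]

theorem BTree.one_le_size (t : BTree) : 1 ≤ t.size := by
  cases t <;> simp [BTree.size]

theorem one_le_sz (a : α) : 1 ≤ sz a := BTree.one_le_size _

@[simp] theorem sz_nil : sz ([] : List α) = 1 := rfl

@[simp] theorem sz_cons (a : α) (l : List α) : sz (a :: l) = sz a + sz l + 1 := rfl

@[simp] theorem sz_pair (a : α) (b : β) : sz (a, b) = sz a + sz b + 1 := rfl

theorem sz_prod (p : α × β) : sz p = sz p.1 + sz p.2 + 1 := rfl

@[simp] theorem sz_nat (n : ℕ) : sz n = 2 * n + 1 := by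
  induction n with
  | zero => rfl
  | succ n ih =>
    have : sz (n + 1) = 1 + sz n + 1 := rfl
    omega

theorem sz_bool_le (b : Bool) : sz b ≤ 3 := by cases b <;> decide

theorem sz_le_of_mem {a : α} {l : List α} (h : a ∈ l) : sz a < sz l := by
  induction l with
  | nil => simp at h
  | cons b l ih =>
    rcases List.mem_cons.1 h with rfl | h
    · simp
    · have := ih h; simp; omega

theorem length_lt_sz (l : List α) : l.length < sz l := by
  induction l with
  | nil => simp
  | cons b l ih => simp; omega

theorem sz_append (l l' : List α) : sz (l ++ l') + 1 = sz l + sz l' := by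
  induction l with
  | nil => simp [Nat.add_comm]
  | cons b l ih => simp; omega

theorem sz_reverse (l : List α) : sz l.reverse = sz l := by
  induction l with
  | nil => rfl
  | cons b l ih =>
    have := sz_append l.reverse [b]
    simp only [List.reverse_cons, sz_cons, sz_nil] at *; omega

theorem sz_sublist {l l' : List α} (h : l.Sublist l') : sz l ≤ sz l' := by
  induction h with
  | slnil => exact le_rfl
  | cons a _ ih => simp; omega
  | cons_cons a _ ih => simp; omega

theorem sz_filter (q : α → Bool) (l : List α) : sz (l.filter q) ≤ sz l :=
  sz_sublist List.filter_sublist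

theorem sz_list_le {l : List α} {c : ℕ} (h : ∀ a ∈ l, sz a ≤ c) : sz l ≤ l.length * (c + 1) + 1 := by
  induction l with
  | nil => simp
  | cons b l ih =>
    have := ih fun a ha => h a (List.mem_cons_of_mem _ ha)
    have := h b List.mem_cons_self
    simp only [sz_cons, List.length_cons, Nat.add_mul]; omega

end Size

/-- `g` is bounded by a polynomial in the size of its argument. -/
@[fun_prop] def PolyBdd {α : Type} [Enc α] (g : α → ℕ) : Prop :=
  ∃ p : Polynomial ℕ, ∀ a, g a ≤ p.eval (sz a)

theorem polynomial_eval_mono (p : Polynomial ℕ) {a b : ℕ} (h : a ≤ b) : p.eval a ≤ p.eval b := by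
  rw [Polynomial.eval_eq_sum, Polynomial.eval_eq_sum]
  exact Finset.sum_le_sum fun i _ => Nat.mul_le_mul_left _ (Nat.pow_le_pow_left h i)

/-! ### Polynomially bounded functions of the size. -/

section PolyBdd

variable {α β : Type} [Enc α] [Enc β] {f g : α → ℕ}

theorem PolyBdd.mono (hg : PolyBdd g) (h : ∀ a, f a ≤ g a) : PolyBdd f :=
  hg.imp fun _ hp a => (h a).trans (hp a)

@[fun_prop] theorem PolyBdd.const (c : ℕ) : PolyBdd fun _ : α => c :=
  ⟨Polynomial.C c, fun _ => by simp⟩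

@[fun_prop] theorem PolyBdd.size : PolyBdd fun a : α => sz a := ⟨Polynomial.X, fun _ => by simp⟩

@[fun_prop] theorem PolyBdd.add (hf : PolyBdd f) (hg : PolyBdd g) :
    PolyBdd fun a => f a + g a := by
  obtain ⟨p, hp⟩ := hf
  obtain ⟨q, hq⟩ := hg
  exact ⟨p + q, fun a => by simpa using Nat.add_le_add (hp a) (hq a)⟩

@[fun_prop] theorem PolyBdd.mul (hf : PolyBdd f) (hg : PolyBdd g) :
    PolyBdd fun a => f a * g a := by
  obtain ⟨p, hp⟩ := hf
  obtain ⟨q, hq⟩ := hg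
  exact ⟨p * q, fun a => by simpa using Nat.mul_le_mul (hp a) (hq a)⟩

@[fun_prop] theorem PolyBdd.eval (q : Polynomial ℕ) (hf : PolyBdd f) :
    PolyBdd fun a => q.eval (f a) := by
  obtain ⟨p, hp⟩ := hf
  exact ⟨q.comp p, fun a => by
    rw [Polynomial.eval_comp]; exact polynomial_eval_mono q (hp a)⟩

end PolyBdd

/-- `f` is computed on encodings by a deterministic program in polynomial time, its values having
polynomial size. The program works on `X₀` and leaves all but finitely many variables unchanged. -/
@[fun_prop] def PT {α β : Type} [Enc α] [Enc β] (f : α → β) : Prop :=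
  PolyBdd (fun a => sz (f a)) ∧ ∃ (P : Prog) (N : ℕ) (q : Polynomial ℕ),
    P.Deterministic ∧ 0 < N ∧ ∀ (a : α) (σ : Store), σ 0 = enc a →
      ∃ (σ' : Store) (m : ℕ), (∀ ω, Exec P (σ, ω) (σ', ω) m) ∧ σ' 0 = enc (f a) ∧
        (∀ y, N ≤ y → σ' y = σ y) ∧ m ≤ q.eval (sz a)

/-! ### Closure of `PT` under composition, pairing, branching and folds. -/

namespace PT

variable {α β γ δ : Type} [Enc α] [Enc β] [Enc γ] [Enc δ]

@[fun_prop] theorem polyBdd {f : α → β} (hf : PT f) : PolyBdd fun a => sz (f a) := hf.1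

/-- A function that is given by an expression. -/
theorem of_expr {f : α → β} (e : Expr) (hb : PolyBdd fun a => sz (f a))
    (he : ∀ (σ : Store) (a : α), σ 0 = enc a → e.eval σ = enc (f a)) : PT f := by
  refine ⟨hb, .assign 0 e, 1, Polynomial.C (e.cost + 1), trivial, one_pos, fun a σ h => ?_⟩
  refine ⟨_, _, fun ω => Exec.assign 0 e σ ω, ?_, ?_, ?_⟩
  · simpa using he σ a h
  · intro y hy
    exact Function.update_of_ne (by omega) _ _
  · simp

@[fun_prop] theorem id : PT fun a : α => a :=
  of_expr (.var 0) PolyBdd.size fun _ _ h => h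

/-- An expression for a given tree. -/
def constExpr : BTree → Expr
  | .nil => .nil
  | .cons a b => .cons (constExpr a) (constExpr b)

theorem constExpr_eval (σ : Store) (t : BTree) : (constExpr t).eval σ = t := by
  induction t with
  | nil => rfl
  | cons a b iha ihb => simp [constExpr, Expr.eval, iha, ihb]

@[fun_prop] theorem const (b : β) : PT fun _ : α => b :=
  of_expr (constExpr (enc b)) (PolyBdd.const _) fun _ _ _ => constExpr_eval _ _

@[fun_prop] theorem comp {g : β → γ} {f : α → β} (hg : PT g) (hf : PT f) :
    PT fun a => g (f a) := by
  obtain ⟨⟨s, hs⟩, P, N, q, hP, hN, h⟩ := hg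
  obtain ⟨⟨s', hs'⟩, P', N', q', hP', hN', h'⟩ := hf
  refine ⟨⟨s.comp s', fun a => ?_⟩, .seq P' P, max N N', q' + q.comp s', ⟨hP', hP⟩, by omega,
    fun a σ hσ => ?_⟩
  · rw [Polynomial.eval_comp]
    exact (hs _).trans (polynomial_eval_mono _ (hs' a))
  · obtain ⟨σ₁, m₁, e₁, v₁, f₁, b₁⟩ := h' a σ hσ
    obtain ⟨σ₂, m₂, e₂, v₂, f₂, b₂⟩ := h (f a) σ₁ v₁
    refine ⟨σ₂, m₁ + m₂, fun ω => .seq (e₁ ω) (e₂ ω), v₂, fun y hy => ?_, ?_⟩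
    · rw [f₂ y (by omega), f₁ y (by omega)]
    · rw [Polynomial.eval_add, Polynomial.eval_comp]
      exact Nat.add_le_add b₁ (b₂.trans (polynomial_eval_mono _ (hs' a)))

theorem of_expr_comp {g : β → γ} {f : α → β} (hf : PT f) (e : Expr)
    (hb : PolyBdd fun a => sz (g a))
    (he : ∀ (σ : Store) (a : β), σ 0 = enc a → e.eval σ = enc (g a)) : PT fun a => g (f a) :=
  comp (of_expr e hb he) hf

@[fun_prop] theorem fst {f : α → β × γ} (hf : PT f) : PT fun a => (f a).1 :=
  of_expr_comp (g := Prod.fst) hf (.hd (.var 0))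
    (PolyBdd.size.mono fun a => by have := sz_prod a; omega)
    fun σ a h => by simp only [Expr.eval, h]; rfl

@[fun_prop] theorem snd {f : α → β × γ} (hf : PT f) : PT fun a => (f a).2 :=
  of_expr_comp (g := Prod.snd) hf (.tl (.var 0))
    (PolyBdd.size.mono fun a => by have := sz_prod a; omega)
    fun σ a h => by simp only [Expr.eval, h]; rfl

-- Either program may overwrite any variable below its bound. The input and the first result are
-- therefore parked in the variables `K` and `K + 1`, which both frame conditions protect. Branching
-- and folding use the same device.
@[fun_prop] theorem prodMk {f : α → β} {g : α → γ} (hf : PT f) (hg : PT g) :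
    PT fun a => (f a, g a) := by
  refine ⟨(((hf.1.add hg.1).add (PolyBdd.const 1))).mono fun a => le_rfl, ?_⟩
  obtain ⟨-, P, N, q, hP, hN, h⟩ := hf
  obtain ⟨-, P', N', q', hP', hN', h'⟩ := hg
  set K := max N N' with hK
  refine ⟨.seq (.assign K (.var 0)) (.seq P (.seq (.assign (K + 1) (.var 0))
      (.seq (.assign 0 (.var K)) (.seq P' (.assign 0 (.cons (.var (K + 1)) (.var 0))))))),
    K + 2, q + q' + Polynomial.C 10, ⟨trivial, hP, trivial, trivial, hP', trivial⟩, by omega,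
    fun a σ hσ => ?_⟩
  obtain ⟨σ₁, m₁, e₁, v₁, f₁, b₁⟩ := h a (Function.update σ K (σ 0)) (by
    rw [Function.update_of_ne (by omega), hσ])
  obtain ⟨σ₂, m₂, e₂, v₂, f₂, b₂⟩ := h' a
    (Function.update (Function.update σ₁ (K + 1) (σ₁ 0)) 0 (σ₁ K)) (by
      rw [Function.update_self, f₁ K (by omega), Function.update_self, hσ])
  refine ⟨_, _, fun ω => .seq (.assign _ _ _ _) (.seq (e₁ ω) (.seq (.assign _ _ _ _)
    (.seq (.assign _ _ _ _) (.seq (?_ : Exec _ _ (σ₂, ω) m₂) (.assign _ _ _ _))))), ?_, ?_, ?_⟩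
  · have hne : K ≠ K + 1 := by omega
    simpa [Expr.eval, hne] using e₂ ω
  · have := f₂ (K + 1) (by omega)
    simp only [Expr.eval, Function.update_self, this, v₂]
    rw [Function.update_of_ne (by omega), Function.update_self, v₁]
    rfl
  · intro y hy
    rw [Function.update_of_ne (by omega), f₂ y (by omega), Function.update_of_ne (by omega),
      Function.update_of_ne (by omega), f₁ y (by omega), Function.update_of_ne (by omega)]
  · simp only [Expr.cost, Polynomial.eval_add, Polynomial.eval_C]; omega

theorem enc_bool_ne_nil (b : Bool) : enc b ≠ BTree.nil ↔ b = true := by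
  cases b <;> simp [enc, BTree.ofBool]

@[fun_prop] theorem cond {c : α → Bool} {f g : α → β} (hc : PT c) (hf : PT f) (hg : PT g) :
    PT fun a => bif c a then f a else g a := by
  refine ⟨(hf.1.add hg.1).mono fun a => by dsimp only; cases c a <;> simp, ?_⟩
  obtain ⟨-, P₀, N₀, q₀, hP₀, hN₀, h₀⟩ := hc
  obtain ⟨-, P, N, q, hP, hN, h⟩ := hf
  obtain ⟨-, P', N', q', hP', hN', h'⟩ := hg
  set K := max N₀ (max N N') with hK
  refine ⟨.seq (.assign K (.var 0)) (.seq P₀ (.seq (.assign (K + 1) (.var 0))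
      (.seq (.assign 0 (.var K)) (.ite (.var (K + 1)) P P')))),
    K + 2, q₀ + q + q' + Polynomial.C 10, ⟨trivial, hP₀, trivial, trivial, hP, hP'⟩, by omega,
    fun a σ hσ => ?_⟩
  obtain ⟨σ₁, m₁, e₁, v₁, f₁, b₁⟩ := h₀ a (Function.update σ K (σ 0)) (by
    rw [Function.update_of_ne (by omega), hσ])
  set σ₂ := Function.update (Function.update σ₁ (K + 1) (σ₁ 0)) 0 (σ₁ K) with hσ₂
  have hσ₂0 : σ₂ 0 = enc a := by
    rw [hσ₂, Function.update_self, f₁ K (by omega), Function.update_self, hσ]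
  have hσ₂K : σ₂ (K + 1) = enc (c a) := by
    rw [hσ₂, Function.update_of_ne (by omega), Function.update_self, v₁]
  have hσ₂f : ∀ y, K + 2 ≤ y → σ₂ y = σ y := fun y hy => by
    rw [hσ₂, Function.update_of_ne (by omega),
      Function.update_of_ne (by omega), f₁ y (by omega), Function.update_of_ne (by omega)]
  have hne : K ≠ K + 1 := by omega
  have key : ∀ σ₃ m₃, (∀ ω, Exec (.ite (.var (K + 1)) P P') (σ₂, ω) (σ₃, ω) m₃) →
      ∃ m, (∀ ω, Exec (.seq (.assign K (.var 0)) (.seq P₀ (.seq (.assign (K + 1) (.var 0))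
      (.seq (.assign 0 (.var K)) (.ite (.var (K + 1)) P P'))))) (σ, ω) (σ₃, ω) m) ∧
      m = m₁ + 6 + m₃ := by
    intro σ₃ m₃ h₃
    refine ⟨_, fun ω => .seq (.assign _ _ _ _) (.seq (e₁ ω) (.seq (.assign _ _ _ _)
      (.seq (.assign _ _ _ _) (?_ : Exec _ _ _ m₃)))), ?_⟩
    · simpa [Expr.eval, hne] using h₃ ω
    · simp only [Expr.cost]; omega
  cases hca : c a with
  | true =>
    obtain ⟨σ₃, m₃, e₃, v₃, f₃, b₃⟩ := h a σ₂ hσ₂0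
    obtain ⟨m, hm, rfl⟩ := key σ₃ _ fun ω => .ite_true (by
      show σ₂ (K + 1) ≠ _
      rw [hσ₂K, enc_bool_ne_nil, hca]) (e₃ ω)
    refine ⟨σ₃, _, hm, by simpa [hca] using v₃, fun y hy => by rw [f₃ y (by omega), hσ₂f y hy], ?_⟩
    simp only [Expr.cost, Polynomial.eval_add, Polynomial.eval_C]; omega
  | false =>
    obtain ⟨σ₃, m₃, e₃, v₃, f₃, b₃⟩ := h' a σ₂ hσ₂0
    obtain ⟨m, hm, rfl⟩ := key σ₃ _ fun ω => .ite_false (by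
      show σ₂ (K + 1) = _
      rw [hσ₂K, hca]; rfl) (e₃ ω)
    refine ⟨σ₃, _, hm, by simpa [hca] using v₃, fun y hy => by rw [f₃ y (by omega), hσ₂f y hy], ?_⟩
    simp only [Expr.cost, Polynomial.eval_add, Polynomial.eval_C]; omega

/-- The loop that folds the list in `X_(K+1)` into `X_(K+2)`, with parameter `X_K`. -/
def foldProg (K : ℕ) (P : Prog) : Prog :=
  .loop (.var (K + 1)) (.seq (.assign 0 (.cons (.var K) (.cons (.var (K + 2)) (.hd (.var (K + 1))))))
    (.seq P (.seq (.assign (K + 2) (.var 0)) (.assign (K + 1) (.tl (.var (K + 1)))))))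

/-- Induction on the list, one loop iteration per element. The running time of the body depends on
the accumulator, so `B` has to dominate it at every prefix of the list. -/
theorem exec_foldProg {s : α → γ → β → γ} {P : Prog} {N K : ℕ} {q : Polynomial ℕ} (hN : 0 < N)
    (hNK : N ≤ K)
    (h : ∀ (a : α × γ × β) (σ : Store), σ 0 = enc a → ∃ (σ' : Store) (m : ℕ),
      (∀ ω, Exec P (σ, ω) (σ', ω) m) ∧ σ' 0 = enc (s a.1 a.2.1 a.2.2) ∧
        (∀ y, N ≤ y → σ' y = σ y) ∧ m ≤ q.eval (sz a)) (a : α) (B : ℕ) (l : List β) (c : γ)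
    (hB : ∀ l₁ b l₂, l = l₁ ++ b :: l₂ → q.eval (sz (a, l₁.foldl (s a) c, b)) ≤ B) (σ : Store)
    (ha : σ K = enc a) (hl : σ (K + 1) = enc l) (hc : σ (K + 2) = enc c) :
    ∃ (σ' : Store) (m : ℕ), (∀ ω, Exec (foldProg K P) (σ, ω) (σ', ω) m) ∧
      σ' (K + 2) = enc (l.foldl (s a) c) ∧ (∀ y, K + 3 ≤ y → σ' y = σ y) ∧
      m ≤ l.length * (B + 20) + 20 := by
  induction l generalizing c σ with
  | nil =>
    refine ⟨σ, _, fun ω => .loop_false (by simp only [Expr.eval, hl]; rfl), hc, fun _ _ => rfl, ?_⟩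
    simp [Expr.cost]
  | cons b l ih =>
    have h0 := hB [] b l rfl
    set σ₁ := Function.update σ 0 (.cons (σ K) (.cons (σ (K + 2)) (σ (K + 1)).hd)) with hσ₁
    obtain ⟨σ₂, m₂, e₂, v₂, f₂, b₂⟩ := h (a, c, b) σ₁ (by
      rw [hσ₁, Function.update_self, ha, hl, hc]; rfl)
    set σ₃ := Function.update (Function.update σ₂ (K + 2) (σ₂ 0)) (K + 1) (σ₂ (K + 1)).tl with hσ₃
    have g₂ : ∀ y, N ≤ y → σ₂ y = σ y := fun y hy => by
      rw [f₂ y hy, hσ₁, Function.update_of_ne (by omega)]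
    obtain ⟨σ₄, m₄, e₄, v₄, f₄, b₄⟩ := ih (s a c b)
      (fun l₁ b' l₂ hl' => hB (b :: l₁) b' l₂ (by rw [hl']; rfl)) σ₃
      (by rw [hσ₃, Function.update_of_ne (by omega), Function.update_of_ne (by omega),
        g₂ _ (by omega), ha])
      (by rw [hσ₃, Function.update_self, g₂ _ (by omega), hl]; rfl)
      (by rw [hσ₃, Function.update_of_ne (by omega), Function.update_self, v₂])
    refine ⟨σ₄, _, fun ω => .loop_true (by simp only [Expr.eval, hl]; exact BTree.noConfusion)
      (.seq (.assign _ _ _ _) (.seq (e₂ ω) (.seq (.assign _ _ _ _) (?_ : Exec _ _ (σ₃, ω) 3))))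
      (e₄ ω), v₄, fun y hy => ?_, ?_⟩
    · have := Exec.assign (K + 1) (.tl (.var (K + 1))) (Function.update σ₂ (K + 2) (σ₂ 0)) ω
      have h2 : (K + 1) ≠ K + 2 := by omega
      simpa [Expr.eval, Expr.cost, Function.update_of_ne h2] using this
    · rw [f₄ y hy, hσ₃, Function.update_of_ne (by omega), Function.update_of_ne (by omega),
        g₂ _ (by omega)]
    · simp only [Expr.cost, List.length_cons, Nat.add_mul] at *
      simp only [List.foldl_nil] at h0
      omega

/-- Folding over a list, when the sizes of all intermediate results are bounded. -/
theorem foldl_of_bound {f : α → List β} {i : α → γ} {s : α → γ → β → γ} (hf : PT f) (hi : PT i)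
    (hs : PT fun p : α × γ × β => s p.1 p.2.1 p.2.2) {g : α → ℕ} (hg : PolyBdd g)
    (hb : ∀ a l₁ l₂, f a = l₁ ++ l₂ → sz (l₁.foldl (s a) (i a)) ≤ g a) :
    PT fun a => (f a).foldl (s a) (i a) := by
  refine ⟨hg.mono fun a => hb a (f a) [] (by simp), ?_⟩
  obtain ⟨G, hG⟩ := hg
  obtain ⟨⟨S, hS⟩, P, N, q, hP, hN, h⟩ := hf
  obtain ⟨-, P', N', q', hP', hN', h'⟩ := hi
  obtain ⟨-, P₀, N₀, q₀, hP₀, hN₀, h₀⟩ := hs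
  set K := max N₀ (max N N') with hK
  refine ⟨.seq (.assign K (.var 0)) (.seq P (.seq (.assign (K + 1) (.var 0))
      (.seq (.assign 0 (.var K)) (.seq P' (.seq (.assign (K + 2) (.var 0))
        (.seq (foldProg K P₀) (.assign 0 (.var (K + 2))))))))),
    -- `S` bounds the size of the list, hence its length and the size of its elements, and `G`
    -- bounds the accumulator. The body thus runs on a triple of size at most `X + G + S + 2`.
    K + 3, q + q' + S * (q₀.comp (Polynomial.X + G + S + Polynomial.C 2) + Polynomial.C 20)
      + Polynomial.C 50,
    ⟨trivial, hP, trivial, trivial, hP', trivial, ⟨trivial, hP₀, trivial, trivial⟩, trivial⟩,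
    by omega, fun a σ hσ => ?_⟩
  have hn1 : K ≠ K + 1 := by omega
  have hn2 : K ≠ K + 2 := by omega
  have hn3 : K + 1 ≠ K + 2 := by omega
  obtain ⟨σ₁, m₁, e₁, v₁, f₁, b₁⟩ := h a (Function.update σ K (σ 0)) (by
    rw [Function.update_of_ne (by omega), hσ])
  set σ₂ := Function.update (Function.update σ₁ (K + 1) (σ₁ 0)) 0 (σ₁ K) with hσ₂
  have hσ₂0 : σ₂ 0 = enc a := by
    rw [hσ₂, Function.update_self, f₁ K (by omega), Function.update_self, hσ]
  obtain ⟨σ₃, m₃, e₃, v₃, f₃, b₃⟩ := h' a σ₂ hσ₂0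
  obtain ⟨σ₄, m₄, e₄, v₄, f₄, b₄⟩ := exec_foldProg hN₀ (by omega : N₀ ≤ K) h₀ a
    (q₀.eval (sz a + G.eval (sz a) + S.eval (sz a) + 2)) (f a) (i a) (by
      intro l₁ b l₂ hl
      apply polynomial_eval_mono
      have h1 := (hb a l₁ _ hl).trans (hG a)
      have h2 : sz b < sz (f a) := sz_le_of_mem (by rw [hl]; simp)
      have h3 : sz (f a) ≤ _ := hS a
      simp only [sz_pair]; omega)
    (Function.update σ₃ (K + 2) (σ₃ 0))
    (by rw [Function.update_of_ne (by omega), f₃ _ (by omega), hσ₂,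
      Function.update_of_ne (by omega), Function.update_of_ne (by omega), f₁ _ (by omega),
      Function.update_self, hσ])
    (by rw [Function.update_of_ne (by omega), f₃ _ (by omega), hσ₂,
      Function.update_of_ne (by omega), Function.update_self, v₁])
    (by rw [Function.update_self, v₃])
  refine ⟨Function.update σ₄ 0 (σ₄ (K + 2)), _, fun ω => .seq (.assign _ _ _ _) (.seq (e₁ ω)
    (.seq (.assign _ _ _ _) (.seq (.assign _ _ _ _) (.seq (?_ : Exec _ _ (σ₃, ω) m₃)
      (.seq (.assign _ _ _ _) (.seq (e₄ ω) (.assign _ _ _ _))))))), ?_, fun y hy => ?_, ?_⟩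
  · simpa [Expr.eval, hn1] using e₃ ω
  · rw [Function.update_self, v₄]
  · rw [Function.update_of_ne (by omega), f₄ y hy, Function.update_of_ne (by omega),
      f₃ y (by omega), hσ₂, Function.update_of_ne (by omega), Function.update_of_ne (by omega),
      f₁ y (by omega), Function.update_of_ne (by omega)]
  · have h1 := (length_lt_sz (f a)).le.trans (hS a)
    have h2 := Nat.mul_le_mul_right
      (q₀.eval (sz a + G.eval (sz a) + S.eval (sz a) + 2) + 20) h1
    simp only [Expr.cost, Polynomial.eval_add, Polynomial.eval_C, Polynomial.eval_mul,
      Polynomial.eval_comp, Polynomial.eval_X]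
    omega

/-- Folding over a list, when every step increases the size by a bounded amount only. -/
theorem foldl_of_growth {f : α → List β} {i : α → γ} {s : α → γ → β → γ} (hf : PT f) (hi : PT i)
    (hs : PT fun p : α × γ × β => s p.1 p.2.1 p.2.2) (I : α → γ → Prop) {g : α → ℕ}
    (hg : PolyBdd g) (h0 : ∀ a, I a (i a)) (hI : ∀ a c b, b ∈ f a → I a c → I a (s a c b))
    (hb : ∀ a c b, b ∈ f a → I a c → sz (s a c b) ≤ sz c + g a) :
    PT fun a => (f a).foldl (s a) (i a) := by
  refine foldl_of_bound hf hi hs (g := fun a => sz (i a) + sz (f a) * g a)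
    (hi.1.add (hf.1.mul hg)) fun a l₁ l₂ hl => ?_
  have key : ∀ (l : List β) c, (∀ b ∈ l, b ∈ f a) → I a c →
      sz (l.foldl (s a) c) ≤ sz c + l.length * g a := by
    intro l
    induction l with
    | nil => simp
    | cons b l ih =>
      intro c hl hc
      have h1 := hl b List.mem_cons_self
      have h2 := ih (s a c b) (fun b' hb' => hl b' (List.mem_cons_of_mem _ hb')) (hI a c b h1 hc)
      have h3 := hb a c b h1 hc
      simp only [List.foldl_cons, List.length_cons, Nat.add_mul]; omega
  have h1 := key l₁ (i a) (fun b hb => by rw [hl]; exact List.mem_append_left _ hb) (h0 a)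
  have h2 := length_lt_sz (f a)
  have h3 : l₁.length ≤ sz (f a) := by
    have := congrArg List.length hl
    simp at this; omega
  have h4 := Nat.mul_le_mul_right (g a) h3
  omega

/-- `foldl_of_growth` without an invariant. -/
theorem foldl {f : α → List β} {i : α → γ} {s : α → γ → β → γ} (hf : PT f) (hi : PT i)
    (hs : PT fun p : α × γ × β => s p.1 p.2.1 p.2.2) {g : α → ℕ} (hg : PolyBdd g)
    (hb : ∀ a c b, b ∈ f a → sz (s a c b) ≤ sz c + g a) :
    PT fun a => (f a).foldl (s a) (i a) :=
  foldl_of_growth hf hi hs (fun _ _ => True) hg (fun _ => trivial) (fun _ _ _ _ _ => trivial)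
    fun a c b h _ => hb a c b h

end PT

/-- `(true, b)` with the first element `b` of the list with the least key, or `(false, d)` if the
list is empty. -/
def minOn {β : Type} (d : β) (key : β → ℕ) (l : List β) : Bool × β :=
  l.foldl (fun acc b => bif !acc.1 || !(Nat.ble (key acc.2) (key b)) then (true, b) else acc)
    (false, d)

namespace PT

variable {α β γ δ : Type} [Enc α] [Enc β] [Enc γ] [Enc δ]

/-! ### Booleans and lists -/

theorem congr {f g : α → β} (hf : PT f) (h : ∀ a, f a = g a) : PT g := by
  rwa [← funext h]

@[fun_prop] theorem not {f : α → Bool} (hf : PT f) : PT fun a => !(f a) :=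
  (hf.cond (const false) (const true)).congr fun a => by cases f a <;> rfl

@[fun_prop] theorem and {f g : α → Bool} (hf : PT f) (hg : PT g) : PT fun a => f a && g a :=
  (hf.cond hg (const false)).congr fun a => by cases f a <;> rfl

@[fun_prop] theorem or {f g : α → Bool} (hf : PT f) (hg : PT g) : PT fun a => f a || g a :=
  (hf.cond (const true) hg).congr fun a => by cases f a <;> rfl

@[fun_prop] theorem cons {f : α → β} {g : α → List β} (hf : PT f) (hg : PT g) :
    PT fun a => f a :: g a :=
  of_expr_comp (g := fun p : β × List β => p.1 :: p.2) (hf.prodMk hg) (.var 0) PolyBdd.size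
    fun _ _ h => h

@[fun_prop] theorem tail {f : α → List β} (hf : PT f) : PT fun a => (f a).tail :=
  of_expr_comp (g := List.tail) hf (.tl (.var 0))
    (PolyBdd.size.mono fun l => sz_sublist l.tail_sublist)
    fun σ l h => by simp only [Expr.eval, h]; cases l <;> rfl

/-- The head operation returns a leaf on a leaf, so the default value has to be encoded by a leaf.
-/
theorem headD_of_enc_eq_nil {f : α → List β} (d : β) (hd : enc d = BTree.nil) (hf : PT f) :
    PT fun a => (f a).headD d :=
  of_expr_comp (g := fun l : List β => l.headD d) hf (.hd (.var 0))
    (PolyBdd.size.mono fun l => by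
      cases l with
      | nil => show (enc d).size ≤ _; rw [hd]; exact one_le_sz _
      | cons b l => simp; omega)
    fun σ l h => by
      simp only [Expr.eval, h]
      cases l with
      | nil => exact hd.symm
      | cons b l => rfl

@[fun_prop] theorem headD_nat {f : α → List ℕ} (hf : PT f) : PT fun a => (f a).headD 0 :=
  headD_of_enc_eq_nil 0 rfl hf

@[fun_prop] theorem headD_bool {f : α → List Bool} (hf : PT f) : PT fun a => (f a).headD false :=
  headD_of_enc_eq_nil false rfl hf

@[fun_prop] theorem headD_list {f : α → List (List β)} (hf : PT f) : PT fun a => (f a).headD [] :=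
  headD_of_enc_eq_nil [] rfl hf

/-- Change of the representation: a function that does not change the encoding. -/
theorem of_enc_eq {g : β → γ} {f : α → β} (hf : PT f) (h : ∀ b, enc (g b) = enc b) :
    PT fun a => g (f a) :=
  of_expr_comp (g := g) hf (.var 0) (PolyBdd.size.mono fun b => by simp [sz, h])
    fun σ b hb => by rw [h]; exact hb

@[fun_prop] theorem reverse {f : α → List β} (hf : PT f) : PT fun a => (f a).reverse := by
  have := foldl (s := fun (_ : α) (acc : List β) b => b :: acc) hf (const []) (by fun_prop)
    (g := fun a => sz (f a) + 1) (by fun_prop) fun a c b hb => by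
      have := sz_le_of_mem hb; simp; omega
  simpa using this

@[fun_prop] theorem append {f g : α → List β} (hf : PT f) (hg : PT g) :
    PT fun a => f a ++ g a := by
  have := foldl (f := fun a => (f a).reverse) (s := fun (_ : α) (acc : List β) b => b :: acc)
    (by fun_prop) hg (by fun_prop)
    (g := fun a => sz (f a) + 1) (by fun_prop) fun a c b hb => by
      have := sz_le_of_mem (List.mem_reverse.1 hb); simp; omega
  simpa using this

theorem sz_pair_le_of_mem (a : α) {b : β} {l : List β} (hb : b ∈ l) : sz (a, b) ≤ sz a + sz l := by
  have := sz_le_of_mem hb; simp; omega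

@[fun_prop] theorem map {f : α → List β} {g : α → β → γ} (hf : PT f)
    (hg : PT fun p : α × β => g p.1 p.2) : PT fun a => (f a).map (g a) := by
  obtain ⟨q, hq⟩ := hg.1
  have := foldl (s := fun (a : α) (acc : List γ) b => g a b :: acc) hf (const [])
    (hg.comp (f := fun p : α × List γ × β => (p.1, p.2.2)) (by fun_prop) |>.cons (by fun_prop))
    (g := fun a => q.eval (sz a + sz (f a)) + 1) (by fun_prop (disch := exact PolyBdd.size))
    fun a c b hb => by
      have h1 := (hq (a, b)).trans (polynomial_eval_mono q (sz_pair_le_of_mem a hb))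
      simp only [sz_cons] at *; omega
  simpa using this.reverse

@[fun_prop] theorem isEmpty {f : α → List β} (hf : PT f) : PT fun a => (f a).isEmpty :=
  (foldl (s := fun (_ : α) (_ : Bool) _ => false) hf (const true) (by fun_prop)
    (g := fun _ => 3) (by fun_prop) fun a c b _ => by simp [sz_bool_le, Nat.le_add_left_of_le]).congr
    fun a => by
      have : ∀ l : List β, l.foldl (fun _ _ => false) false = false := fun l => by
        induction l <;> simp_all
      cases f a <;> simp [this]

@[fun_prop] theorem filter {f : α → List β} {g : α → β → Bool} (hf : PT f)
    (hg : PT fun p : α × β => g p.1 p.2) : PT fun a => (f a).filter (g a) := by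
  have h := foldl (s := fun (a : α) (acc : List β) b => bif g a b then b :: acc else acc) hf
    (const []) ((hg.comp (f := fun p : α × List β × β => (p.1, p.2.2)) (by fun_prop)).cond
      (by fun_prop) (by fun_prop)) (g := fun a => sz (f a) + 1) (by fun_prop) fun a c b hb => by
      have := sz_le_of_mem hb
      cases g a b <;> simp; omega
  refine h.reverse.congr fun a => ?_
  have : ∀ (l c : List β), l.foldl (fun acc b => bif g a b then b :: acc else acc) c =
      (l.filter (g a)).reverse ++ c := fun l => by
    induction l with
    | nil => simp
    | cons b l ih => intro c; cases hb : g a b <;> simp [ih, hb]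
  simp [this]

@[fun_prop] theorem flatMap {f : α → List β} {g : α → β → List γ} (hf : PT f)
    (hg : PT fun p : α × β => g p.1 p.2) : PT fun a => (f a).flatMap (g a) := by
  obtain ⟨q, hq⟩ := hg.1
  have h := foldl (s := fun (a : α) (acc : List γ) b => acc ++ g a b) hf (const [])
    (append (by fun_prop) (hg.comp (f := fun p : α × List γ × β => (p.1, p.2.2)) (by fun_prop)))
    (g := fun a => q.eval (sz a + sz (f a)) + 1) (by fun_prop) fun a c b hb => by
      have h1 := (hq (a, b)).trans (polynomial_eval_mono q (sz_pair_le_of_mem a hb))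
      have := sz_append c (g a b)
      simp only at *; omega
  refine h.congr fun a => ?_
  have : ∀ (l : List β) (c : List γ), l.foldl (fun acc b => acc ++ g a b) c =
      c ++ l.flatMap (g a) := fun l => by
    induction l with
    | nil => simp
    | cons b l ih => intro c; simp [ih]
  simp [this]

@[fun_prop] theorem any {f : α → List β} {g : α → β → Bool} (hf : PT f)
    (hg : PT fun p : α × β => g p.1 p.2) : PT fun a => (f a).any (g a) :=
  (hf.filter hg).isEmpty.not.congr fun a => by
    rw [Bool.eq_iff_iff]; simp [List.filter_eq_nil_iff]

@[fun_prop] theorem all {f : α → List β} {g : α → β → Bool} (hf : PT f)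
    (hg : PT fun p : α × β => g p.1 p.2) : PT fun a => (f a).all (g a) :=
  (hf.filter (g := fun a b => !(g a b)) hg.not).isEmpty.congr fun a => by
    rw [Bool.eq_iff_iff]; simp [List.filter_eq_nil_iff]

/-! ### Natural numbers -/

/-- Unary numbers and lists over `Unit` are the same trees, so arithmetic is inherited from lists:
appending gives sums, `flatMap` products, `drop` truncated differences. -/
theorem enc_replicate (n : ℕ) : enc (List.replicate n ()) = enc n := by
  induction n with
  | zero => rfl
  | succ n ih => exact congrArg (BTree.cons .nil) ih

@[fun_prop] theorem replicate {f : α → ℕ} (hf : PT f) : PT fun a => List.replicate (f a) () :=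
  of_enc_eq hf enc_replicate

@[fun_prop] theorem length {f : α → List β} (hf : PT f) : PT fun a => (f a).length :=
  (of_enc_eq (g := fun l : List Unit => l.length) (f := fun a => (f a).map fun _ => ())
    (by fun_prop) fun l => by
      rw [← enc_replicate, ← List.eq_replicate_of_mem (a := ()) fun _ _ => rfl]).congr fun a => by
    simp

@[fun_prop] theorem add {f g : α → ℕ} (hf : PT f) (hg : PT g) : PT fun a => f a + g a :=
  (length (f := fun a => List.replicate (f a) () ++ List.replicate (g a) ()) (by fun_prop)).congr
    fun a => by simp

@[fun_prop] theorem mul {f g : α → ℕ} (hf : PT f) (hg : PT g) : PT fun a => f a * g a :=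
  (length (f := fun a => (List.replicate (f a) ()).flatMap fun _ => List.replicate (g a) ())
    (by fun_prop)).congr fun a => by simp

@[fun_prop] theorem drop {f : α → ℕ} {g : α → List β} (hf : PT f) (hg : PT g) :
    PT fun a => (g a).drop (f a) :=
  (foldl (f := fun a => List.replicate (f a) ()) (i := g) (s := fun _ c _ => c.tail)
    (by fun_prop) hg (by fun_prop) (g := fun _ => 0) (by fun_prop)
    fun a c b _ => sz_sublist c.tail_sublist).congr fun a => by
      have : ∀ (n : ℕ) (l : List β), (List.replicate n ()).foldl (fun c _ => c.tail) l = l.drop n :=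
        fun n => by
          induction n with
          | zero => simp
          | succ n ih => intro l; simp [List.replicate_succ, ih]
      exact this _ _

@[fun_prop] theorem sub {f g : α → ℕ} (hf : PT f) (hg : PT g) : PT fun a => f a - g a :=
  (length (f := fun a => (List.replicate (f a) ()).drop (g a)) (by fun_prop)).congr fun a => by simp

@[fun_prop] theorem ble {f g : α → ℕ} (hf : PT f) (hg : PT g) : PT fun a => Nat.ble (f a) (g a) :=
  (isEmpty (f := fun a => List.replicate (f a - g a) ()) (by fun_prop)).congr fun a => by
    rw [Bool.eq_iff_iff]; simp [Nat.sub_eq_zero_iff_le]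

@[fun_prop] theorem beq {f g : α → ℕ} (hf : PT f) (hg : PT g) : PT fun a => Nat.beq (f a) (g a) :=
  (and (f := fun a => Nat.ble (f a) (g a)) (g := fun a => Nat.ble (g a) (f a)) (by fun_prop)
    (by fun_prop)).congr fun a => by
    rw [Bool.eq_iff_iff]; simp [Nat.le_antisymm_iff]

@[fun_prop] theorem take {f : α → ℕ} {g : α → List β} (hf : PT f) (hg : PT g) :
    PT fun a => (g a).take (f a) :=
  (reverse (f := fun a => (g a).reverse.drop ((g a).length - f a)) (by fun_prop)).congr fun a => by
    rw [List.drop_reverse, List.reverse_reverse]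
    rcases le_total (f a) (g a).length with h | h
    · rw [Nat.sub_sub_self h]
    · rw [Nat.sub_eq_zero_of_le h, Nat.sub_zero, List.take_length, List.take_of_length_le h]

@[fun_prop] theorem range {f : α → ℕ} (hf : PT f) : PT fun a => List.range (f a) := by
  -- The length of the list built so far serves as the counter, so the numbers come out in
  -- descending order.
  have key : ∀ l : List Unit, l.foldl (fun c _ => c.length :: c) [] =
      (List.range l.length).reverse := fun l => by
    induction l using List.reverseRecOn with
    | nil => rfl
    | append_singleton l u ih => simp [ih, List.range_succ]
  have h := foldl_of_bound (f := fun a => List.replicate (f a) ())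
    (s := fun _ c _ => c.length :: c) (by fun_prop) (const ([] : List ℕ)) (by fun_prop)
    (g := fun a => sz (f a) * (2 * sz (f a) + 2) + 1) (by fun_prop) fun a l₁ l₂ hl => by
      have h1 := congrArg List.length hl
      rw [List.length_replicate, List.length_append] at h1
      rw [key, sz_reverse]
      refine (sz_list_le (c := 2 * l₁.length + 1) fun i hi => ?_).trans ?_
      · have := List.mem_range.1 hi; simp; omega
      · rw [List.length_range]
        have h2 : l₁.length ≤ sz (f a) := by simp; omega
        have := Nat.mul_le_mul h2 (by omega : 2 * l₁.length + 1 + 1 ≤ 2 * sz (f a) + 2)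
        omega
  exact h.reverse.congr fun a => by simp [key]

@[fun_prop] theorem contains {f : α → List ℕ} {g : α → ℕ} (hf : PT f) (hg : PT g) :
    PT fun a => (f a).contains (g a) :=
  (any (f := f) (g := fun a x => Nat.beq (g a) x) hf (by fun_prop)).congr fun a => by
    rw [Bool.eq_iff_iff]; simp

@[fun_prop] theorem minOn {f : α → List β} {key : α → β → ℕ} (d : β) (hf : PT f)
    (hk : PT fun p : α × β => key p.1 p.2) : PT fun a => minOn d (key a) (f a) := by
  refine foldl_of_growth (s := fun (a : α) (acc : Bool × β) b =>
    bif !acc.1 || !(Nat.ble (key a acc.2) (key a b)) then (true, b) else acc) hf (const (false, d))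
    ?_ (fun _ _ => True) (g := fun a => sz (f a) + 5) (by fun_prop) (fun _ => trivial)
    (fun _ _ _ _ _ => trivial) fun a c b hb _ => ?_
  · have h1 := hk.comp (f := fun p : α × (Bool × β) × β => (p.1, p.2.1.2)) (by fun_prop)
    have h2 := hk.comp (f := fun p : α × (Bool × β) × β => (p.1, p.2.2)) (by fun_prop)
    exact cond (or (by fun_prop) (not (ble h1 h2))) (by fun_prop) (by fun_prop)
  · have := sz_le_of_mem hb
    have := sz_bool_le true
    cases !c.1 || !(Nat.ble (key a c.2) (key a b)) <;> simp; omega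

end PT

/-! ## The algorithm -/

/-- Adjacency matrices. -/
abbrev Mat := List (List Bool)

/-- Snapshots with their time steps. -/
abbrev Item := ℕ × Mat

/-- A phase: its number, the snapshots for moving to a vertex, and the snapshots for following the
tour. -/
abbrev Phase := ℕ × List Item × List Item

/-- Adjacency of `x` and `y`; it is `false` for numbers that are not vertices. -/
def adj (M : Mat) (x y : ℕ) : Bool := (((M.drop x).headD []).drop y).headD false

/-- The list of snapshots with their time steps. -/
def timed (Gs : List Mat) : List Item :=
  (List.range Gs.length).map fun t => (t, (Gs.drop t).headD [])

/-- The phases, each of which consists of two intervals of `D` time steps. -/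
def phases (I : List Item) (D : ℕ) : List Phase :=
  ((List.range (I.length + 1)).filter fun p => Nat.ble ((p + 1) * (D + D)) I.length).map
    fun p => (p, (I.drop (p * (D + D))).take D, (I.drop (p * (D + D) + D)).take D)

/-- The number of snapshots in which `x` and `y` are not adjacent. -/
def miss (w : List Item) (x y : ℕ) : ℕ := (w.filter fun it => !adj it.2 x y).length

/-- The positions of a tour, paired with the vertices that are not on the tour. -/
def extensions (n : ℕ) (tour : List ℕ) : List (ℕ × ℕ) :=
  (List.range tour.length).flatMap fun i =>
    ((List.range n).filter fun y => !tour.contains y).map fun y => (i, y)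

/-- The cheapest extension of a tour. -/
def bestExtension (n : ℕ) (w : List Item) (tour : List ℕ) : Bool × ℕ × ℕ :=
  minOn (0, 0) (fun c => miss w ((tour.drop c.1).headD 0) c.2) (extensions n tour)

/-- Extend a tour by a detour to a new vertex. -/
def extendTour (n : ℕ) (w : List Item) (tour : List ℕ) : List ℕ :=
  bif (bestExtension n w tour).1 then
    -- Both `take (i + 1)` and `drop i` contain the vertex at position `i`: the detour leads from it
    -- to the new vertex and back.
    tour.take ((bestExtension n w tour).2.1 + 1) ++
      (bestExtension n w tour).2.2 :: tour.drop (bestExtension n w tour).2.1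
  else tour

/-- A closed tour along a minimum spanning tree (Prim's algorithm), starting at `v`. -/
def tourFrom (n : ℕ) (w : List Item) (v : ℕ) : List ℕ :=
  (List.replicate n ()).foldl (fun t _ => extendTour n w t) [v]

/-- One time step of an agent that follows a tour, waiting when the next edge is missing. The agent
is described by the rest of its tour, which starts with its current vertex, and its moves so far
(the last move first). -/
def runStep (s : List ℕ × List (ℕ × ℕ)) (it : Item) : List ℕ × List (ℕ × ℕ) :=
  bif !s.1.tail.isEmpty && adj it.2 (s.1.headD 0) (s.1.tail.headD 0) then
    (s.1.tail, (it.1, s.1.tail.headD 0) :: s.2)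
  else s

/-- Follow a tour. -/
def run (w : List Item) (S : List ℕ) : List ℕ × List (ℕ × ℕ) := w.foldl runStep (S, [])

/-- Look up the tour assigned to phase number `p`. -/
def assigned (A : List (ℕ × List ℕ)) (p : ℕ) : List ℕ :=
  A.foldl (fun acc e => bif Nat.beq e.1 p then e.2 else acc) []

/-- The unassigned phase in which an agent gets farthest on the tour `S`. -/
def bestPhase (ph : List Phase) (S : List ℕ) (A : List (ℕ × List ℕ)) : Bool × Phase :=
  minOn (0, [], []) (fun q => (run q.2.2 S).1.length)
    -- The empty list marks a free phase; this is unambiguous because `greedyStep` assigns nonempty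
    -- tours only.
    (ph.filter fun q => (assigned A q.1).isEmpty)

/-- Assign the rest of the tour to a phase and cut off what is visited in this phase. -/
def greedyStep (ph : List Phase) (s : List ℕ × List (ℕ × List ℕ)) :
    List ℕ × List (ℕ × List ℕ) :=
  bif !s.1.isEmpty && (bestPhase ph s.1 s.2).1 then
    -- The vertex where the run ends is visited too, hence the `tail`. The edge to the next vertex
    -- is never needed, since the phase taking over first moves to the start of its own piece.
    ((run (bestPhase ph s.1 s.2).2.2.2 s.1).1.tail, ((bestPhase ph s.1 s.2).2.1, s.1) :: s.2)
  else s

/-- Distribute a tour over the phases. -/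
def greedy (ph : List Phase) (S : List ℕ) : List ℕ × List (ℕ × List ℕ) :=
  ph.foldl (fun s _ => greedyStep ph s) (S, [])

/-- The vertices from which `x` can be reached by a temporal walk in the snapshots `w`. -/
def back (n x : ℕ) (w : List Item) : List ℕ :=
  w.reverse.foldl (fun B it => (List.range n).filter fun y =>
    B.contains y || B.any fun z => adj it.2 y z) [x]

/-- The neighbours of `u` from which `x` can be reached in the snapshots `w`. -/
def gotoNext (n x : ℕ) (it : Item) (w : List Item) (u : ℕ) : List ℕ :=
  (List.range n).filter fun z => adj it.2 u z && (back n x w).contains z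

/-- One time step of an agent that moves to `x`. -/
def gotoStep (n x : ℕ) (s : List Item × ℕ × List (ℕ × ℕ)) (it : Item) :
    List Item × ℕ × List (ℕ × ℕ) :=
  -- Here `s.1.tail` consists of the snapshots after the current one: the agent waits if `x` remains
  -- reachable without using this step, or if no move helps.
  bif (back n x s.1.tail).contains s.2.1 || (gotoNext n x it s.1.tail s.2.1).isEmpty then
    (s.1.tail, s.2)
  else (s.1.tail, (gotoNext n x it s.1.tail s.2.1).headD 0,
    (it.1, (gotoNext n x it s.1.tail s.2.1).headD 0) :: s.2.2)

/-- Move from `u` to `x` in the snapshots `w`. -/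
def goto (n x : ℕ) (w : List Item) (u : ℕ) : ℕ × List (ℕ × ℕ) :=
  (w.foldl (gotoStep n x) (w, u, [])).2

/-- Carry out one phase. -/
def travelStep (n : ℕ) (A : List (ℕ × List ℕ)) (s : ℕ × List (ℕ × ℕ)) (q : Phase) :
    ℕ × List (ℕ × ℕ) :=
  bif (assigned A q.1).isEmpty then s
  else bif Nat.beq (goto n ((assigned A q.1).headD 0) q.2.1 s.1).1 ((assigned A q.1).headD 0) then
    ((run q.2.2 (assigned A q.1)).1.headD 0, (run q.2.2 (assigned A q.1)).2 ++
      ((goto n ((assigned A q.1).headD 0) q.2.1 s.1).2 ++ s.2))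
  -- If the target is missed, the piece is skipped, so that the plan is a temporal walk even for an
  -- unsuitable `D`.
  else ((goto n ((assigned A q.1).headD 0) q.2.1 s.1).1,
    (goto n ((assigned A q.1).headD 0) q.2.1 s.1).2 ++ s.2)

/-- Carry out all phases. -/
def travel (n : ℕ) (A : List (ℕ × List ℕ)) (ph : List Phase) (v : ℕ) : ℕ × List (ℕ × ℕ) :=
  ph.foldl (travelStep n A) (v, [])

/-- The walk that is planned for the given phases. -/
def plan (n v : ℕ) (ph : List Phase) : List (ℕ × ℕ) :=
  (travel n (greedy ph (tourFrom n (ph.flatMap fun q => q.2.2) v)).2 ph v).2.reverse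

/-- Whether a walk from `v` visits all vertices. -/
def visitsAll (n v : ℕ) (w : List (ℕ × ℕ)) : Bool :=
  (List.range n).all fun y => (v :: w.map fun m => m.2).contains y

/-- The algorithm. -/
def solve (x : ℕ × ℕ × List Mat) : List (ℕ × ℕ) :=
  -- The right interval length depends on `Δ` and `k`, which are not given; every length up to the
  -- lifetime is tried and the outcome checked.
  (List.range (x.2.2.length + 1)).foldl (fun acc D =>
    bif visitsAll x.1 x.2.1 (plan x.1 x.2.1 (phases (timed x.2.2) D)) then
      plan x.1 x.2.1 (phases (timed x.2.2) D) else acc) []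

/-! ### The algorithm runs in polynomial time -/

theorem foldl_measure_le {β γ : Type} {s : γ → β → γ} (μ : γ → ℕ) (K : ℕ) (l : List β)
    (h : ∀ c, ∀ b ∈ l, μ (s c b) ≤ μ c + K) (c : γ) :
    μ (l.foldl s c) ≤ μ c + l.length * K := by
  induction l generalizing c with
  | nil => simp
  | cons b l ih =>
    have h1 := ih (fun c b hb => h c b (List.mem_cons_of_mem _ hb)) (s c b)
    have h2 := h c b List.mem_cons_self
    simp only [List.foldl_cons, List.length_cons, Nat.add_mul]; omega

theorem sz_headD_le (l : List ℕ) : sz (l.headD 0) ≤ sz l := by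
  cases l <;> simp; omega

theorem sz_tail_le {α : Type} [Enc α] (l : List α) : sz l.tail ≤ sz l :=
  sz_sublist l.tail_sublist

namespace PT

variable {α : Type} [Enc α]

@[fun_prop] theorem adj {M : α → Mat} {x y : α → ℕ} (hM : PT M) (hx : PT x) (hy : PT y) :
    PT fun a => adj (M a) (x a) (y a) := by
  unfold TemporalExploration.adj; fun_prop

@[fun_prop] theorem timed {f : α → List Mat} (hf : PT f) : PT fun a => timed (f a) := by
  unfold TemporalExploration.timed; fun_prop

@[fun_prop] theorem phases {f : α → List Item} {D : α → ℕ} (hf : PT f) (hD : PT D) :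
    PT fun a => phases (f a) (D a) := by
  unfold TemporalExploration.phases; fun_prop

@[fun_prop] theorem miss {w : α → List Item} {x y : α → ℕ} (hw : PT w) (hx : PT x) (hy : PT y) :
    PT fun a => miss (w a) (x a) (y a) := by
  unfold TemporalExploration.miss; fun_prop

@[fun_prop] theorem extensions {n : α → ℕ} {t : α → List ℕ} (hn : PT n) (ht : PT t) :
    PT fun a => extensions (n a) (t a) := by
  unfold TemporalExploration.extensions; fun_prop

@[fun_prop] theorem bestExtension {n : α → ℕ} {w : α → List Item} {t : α → List ℕ} (hn : PT n)
    (hw : PT w) (ht : PT t) : PT fun a => bestExtension (n a) (w a) (t a) := by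
  unfold TemporalExploration.bestExtension; fun_prop

@[fun_prop] theorem extendTour {n : α → ℕ} {w : α → List Item} {t : α → List ℕ} (hn : PT n)
    (hw : PT w) (ht : PT t) : PT fun a => extendTour (n a) (w a) (t a) := by
  unfold TemporalExploration.extendTour; fun_prop

@[fun_prop] theorem runStep {s : α → List ℕ × List (ℕ × ℕ)} {it : α → Item} (hs : PT s)
    (hi : PT it) : PT fun a => runStep (s a) (it a) := by
  unfold TemporalExploration.runStep; fun_prop

-- The rest of the tour only shrinks; this invariant bounds the vertex in every recorded move and
-- makes the growth additive.
@[fun_prop] theorem run {w : α → List Item} {S : α → List ℕ} (hw : PT w) (hS : PT S) :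
    PT fun a => run (w a) (S a) := by
  refine foldl_of_growth (i := fun a => (S a, [])) (s := fun _ => TemporalExploration.runStep) hw
    (by fun_prop) (by fun_prop) (fun a c => sz c.1 ≤ sz (S a))
    (g := fun a => sz (w a) + sz (S a) + 5) (by fun_prop) (fun a => le_rfl) ?_ ?_
  · intro a c b _ hc
    have := sz_tail_le c.1
    unfold TemporalExploration.runStep
    cases !c.1.tail.isEmpty && _
    · exact hc
    · exact this.trans hc
  · intro a c b hb hc
    have h1 := sz_tail_le c.1
    have h2 := sz_headD_le c.1.tail
    have h3 := sz_le_of_mem hb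
    unfold TemporalExploration.runStep
    cases !c.1.tail.isEmpty && _
    · simp
    · simp only [cond_true, sz_prod, sz_cons] at *; omega

@[fun_prop] theorem assigned {A : α → List (ℕ × List ℕ)} {p : α → ℕ} (hA : PT A) (hp : PT p) :
    PT fun a => assigned (A a) (p a) := by
  refine foldl (s := fun a acc e => bif Nat.beq e.1 (p a) then e.2 else acc) hA (const [])
    (by fun_prop) (g := fun a => sz (A a)) (by fun_prop) fun a c b hb => ?_
  have h3 := sz_le_of_mem hb
  cases Nat.beq b.1 (p a) <;> simp only [cond_true, cond_false, sz_prod] at *; omega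
  omega

@[fun_prop] theorem bestPhase {ph : α → List Phase} {S : α → List ℕ} {A : α → List (ℕ × List ℕ)}
    (hp : PT ph) (hS : PT S) (hA : PT A) : PT fun a => bestPhase (ph a) (S a) (A a) := by
  unfold TemporalExploration.bestPhase; fun_prop

@[fun_prop] theorem greedyStep {ph : α → List Phase} {s : α → List ℕ × List (ℕ × List ℕ)}
    (hp : PT ph) (hs : PT s) : PT fun a => greedyStep (ph a) (s a) := by
  unfold TemporalExploration.greedyStep; fun_prop

@[fun_prop] theorem back {n x : α → ℕ} {w : α → List Item} (hn : PT n) (hx : PT x) (hw : PT w) :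
    PT fun a => back (n a) (x a) (w a) := by
  refine foldl (f := fun a => (w a).reverse) (i := fun a => [x a])
    (s := fun a B it => (List.range (n a)).filter fun y =>
    B.contains y || B.any fun z => TemporalExploration.adj it.2 y z) (by fun_prop) (by fun_prop)
    (by fun_prop) (g := fun a => sz (List.range (n a))) (by fun_prop) fun a c b _ => ?_
  exact (sz_filter _ _).trans (Nat.le_add_left _ _)

@[fun_prop] theorem gotoNext {n x : α → ℕ} {it : α → Item} {w : α → List Item} {u : α → ℕ}
    (hn : PT n) (hx : PT x) (hi : PT it) (hw : PT w) (hu : PT u) :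
    PT fun a => gotoNext (n a) (x a) (it a) (w a) (u a) := by
  unfold TemporalExploration.gotoNext; fun_prop

@[fun_prop] theorem gotoStep {n x : α → ℕ} {s : α → List Item × ℕ × List (ℕ × ℕ)} {it : α → Item}
    (hn : PT n) (hx : PT x) (hs : PT s) (hi : PT it) :
    PT fun a => gotoStep (n a) (x a) (s a) (it a) := by
  unfold TemporalExploration.gotoStep; fun_prop

end PT

/-! ### Specifications of the elementary steps of the algorithm. -/

theorem minOn_spec {β : Type} (d : β) (key : β → ℕ) (l : List β) :
    (l = [] ∧ minOn d key l = (false, d)) ∨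
      ((minOn d key l).1 = true ∧ (minOn d key l).2 ∈ l ∧
        ∀ b ∈ l, key (minOn d key l).2 ≤ key b) := by
  induction l using List.reverseRecOn with
  | nil => exact Or.inl ⟨rfl, rfl⟩
  | append_singleton l b ih =>
    right
    have h : minOn d key (l ++ [b]) = bif !(minOn d key l).1 ||
        !(Nat.ble (key (minOn d key l).2) (key b)) then (true, b) else minOn d key l := by
      simp [minOn]
    rw [h]
    rcases ih with ⟨rfl, h0⟩ | ⟨h1, h2, h3⟩
    · simp [h0]
    · rw [h1]
      by_cases hb : key (minOn d key l).2 ≤ key b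
      · have : Nat.ble (key (minOn d key l).2) (key b) = true := by rwa [Nat.ble_eq]
        simp only [this, Bool.not_true, Bool.or_false, cond_false]
        refine ⟨h1, List.mem_append_left _ h2, fun c hc => ?_⟩
        rcases List.mem_append.1 hc with hc | hc
        · exact h3 c hc
        · rwa [List.mem_singleton.1 hc]
      · have : Nat.ble (key (minOn d key l).2) (key b) = false := by
          rw [← Bool.not_eq_true, Nat.ble_eq]; exact hb
        simp only [this, Bool.not_true, Bool.not_false, Bool.or_true, cond_true]
        refine ⟨trivial, by simp, fun c hc => ?_⟩
        rcases List.mem_append.1 hc with hc | hc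
        · exact (le_of_not_ge hb).trans (h3 c hc)
        · rw [List.mem_singleton.1 hc]

theorem mem_extensions {n : ℕ} {t : List ℕ} {c : ℕ × ℕ} :
    c ∈ extensions n t ↔ c.1 < t.length ∧ c.2 < n ∧ c.2 ∉ t := by
  obtain ⟨i, y⟩ := c
  simp [extensions]

/-- Either the tour contains all vertices, or it is extended as cheaply as possible. -/
theorem extendTour_spec (n : ℕ) (w : List Item) (t : List ℕ) :
    (extendTour n w t = t ∧ extensions n t = []) ∨
    ∃ i y, i < t.length ∧ y < n ∧ y ∉ t ∧
      extendTour n w t = t.take (i + 1) ++ y :: t.drop i ∧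
      ∀ j z, j < t.length → z < n → z ∉ t →
        miss w ((t.drop i).headD 0) y ≤ miss w ((t.drop j).headD 0) z := by
  unfold extendTour
  rcases minOn_spec (0, 0) (fun c : ℕ × ℕ => miss w ((t.drop c.1).headD 0) c.2) (extensions n t)
    with ⟨h0, h⟩ | ⟨h1, h2, h3⟩
  · left
    refine ⟨?_, h0⟩
    have : bestExtension n w t = (false, 0, 0) := h
    simp [this]
  · right
    change (bestExtension n w t).1 = true at h1
    obtain ⟨hi, hy, hyt⟩ := mem_extensions.1 h2
    refine ⟨_, _, hi, hy, hyt, by rw [h1]; rfl, fun j z hj hz hzt => ?_⟩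
    exact h3 (j, z) (mem_extensions.2 ⟨hj, hz, hzt⟩)

theorem headD_drop {α : Type} (d : α) {l : List α} {i : ℕ} (h : i < l.length) :
    (l.drop i).headD d = l[i] := by
  rw [List.drop_eq_getElem_cons h]; rfl

theorem sz_extend {t : List ℕ} {i : ℕ} (h : i < t.length) (y : ℕ) :
    sz (t.take (i + 1) ++ y :: t.drop i) = sz t + sz t[i] + sz y + 2 := by
  have h1 := sz_append (t.take (i + 1)) (y :: t.drop i)
  have h2 := sz_append (t.take i) (t.drop i)
  have h3 := sz_append (t.take i) [t[i]]
  rw [List.take_append_drop] at h2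
  rw [← List.take_append_getElem h] at h1
  rw [← List.take_append_getElem h]
  simp only [sz_cons, sz_nil] at *
  omega

theorem runStep_cases (s : List ℕ × List (ℕ × ℕ)) (it : Item) :
    (∃ x y l, s.1 = x :: y :: l ∧ adj it.2 x y = true ∧ runStep s it = (y :: l, (it.1, y) :: s.2)) ∨
    (runStep s it = s ∧ ∀ x y l, s.1 = x :: y :: l → adj it.2 x y = false) := by
  obtain ⟨S, mv⟩ := s
  match S with
  | [] => right; simp [runStep]
  | [x] => right; simp [runStep]
  | x :: y :: l =>
    cases h : adj it.2 x y with
    | true => left; exact ⟨x, y, l, rfl, h, by simp [runStep, h]⟩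
    | false =>
      right
      refine ⟨by simp [runStep, h], fun x' y' l' h' => ?_⟩
      simp only [List.cons.injEq] at h'
      rw [← h'.1, ← h'.2.1, h]

theorem runStep_suffix (s : List ℕ × List (ℕ × ℕ)) (it : Item) : (runStep s it).1 <:+ s.1 := by
  rcases runStep_cases s it with ⟨x, y, l, h, -, h'⟩ | ⟨h, -⟩
  · rw [h, h']; exact List.suffix_cons _ _
  · rw [h]

theorem foldl_runStep_suffix (w : List Item) (s : List ℕ × List (ℕ × ℕ)) :
    (w.foldl runStep s).1 <:+ s.1 := by
  induction w generalizing s with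
  | nil => exact List.suffix_rfl
  | cons it w ih => exact (ih _).trans (runStep_suffix s it)

theorem run_suffix (w : List Item) (S : List ℕ) : (run w S).1 <:+ S :=
  foldl_runStep_suffix w (S, [])

theorem greedyStep_cases (ph : List Phase) (s : List ℕ × List (ℕ × List ℕ)) :
    (∃ q ∈ ph, assigned s.2 q.1 = [] ∧ s.1 ≠ [] ∧
      greedyStep ph s = ((run q.2.2 s.1).1.tail, (q.1, s.1) :: s.2) ∧
      ∀ q' ∈ ph, assigned s.2 q'.1 = [] → (run q.2.2 s.1).1.length ≤ (run q'.2.2 s.1).1.length) ∨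
    (greedyStep ph s = s ∧ (s.1 = [] ∨ ∀ q ∈ ph, assigned s.2 q.1 ≠ [])) := by
  unfold greedyStep
  by_cases hs : s.1 = []
  · right; simp [hs]
  rcases minOn_spec ((0, [], []) : Phase) (fun q => (run q.2.2 s.1).1.length)
    (ph.filter fun q => (assigned s.2 q.1).isEmpty) with ⟨h0, h⟩ | ⟨h1, h2, h3⟩
  · right
    have : bestPhase ph s.1 s.2 = (false, 0, [], []) := h
    refine ⟨by simp [this], Or.inr fun q hq => ?_⟩
    simpa using List.filter_eq_nil_iff.1 h0 q hq
  · left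
    change (bestPhase ph s.1 s.2).1 = true at h1
    obtain ⟨h4, h5⟩ := List.mem_filter.1 h2
    refine ⟨_, h4, by simpa using h5, hs, ?_, fun q' hq' hq'' =>
      h3 q' (List.mem_filter.2 ⟨hq', by simpa using hq''⟩)⟩
    rw [h1, Bool.and_true, cond_eq_ite, if_pos (by simpa using hs)]
    rfl

theorem gotoStep_cases (n x : ℕ) (s : List Item × ℕ × List (ℕ × ℕ)) (it : Item) :
    (gotoStep n x s it = (s.1.tail, s.2) ∧
      (s.2.1 ∈ back n x s.1.tail ∨ ∀ z < n, adj it.2 s.2.1 z = true → z ∉ back n x s.1.tail)) ∨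
    ∃ z < n, adj it.2 s.2.1 z = true ∧ z ∈ back n x s.1.tail ∧
      gotoStep n x s it = (s.1.tail, z, (it.1, z) :: s.2.2) := by
  unfold gotoStep
  by_cases h : s.2.1 ∈ back n x s.1.tail
  · left
    refine ⟨by simp [h], Or.inl h⟩
  cases hl : gotoNext n x it s.1.tail s.2.1 with
  | nil =>
    left
    refine ⟨by simp, Or.inr fun z hz ha hb => ?_⟩
    have := List.filter_eq_nil_iff.1 hl z (List.mem_range.2 hz)
    simp [ha, hb] at this
  | cons z l =>
    right
    have hz : z ∈ gotoNext n x it s.1.tail s.2.1 := by rw [hl]; exact List.mem_cons_self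
    obtain ⟨h1, h2⟩ := List.mem_filter.1 hz
    simp only [Bool.and_eq_true, List.contains_iff_mem] at h2
    refine ⟨z, List.mem_range.1 h1, h2.1, h2.2, ?_⟩
    simp [h]

/-- Bounds for the sizes of the final vertex and of the moves. -/
theorem sz_goto_le (n x : ℕ) (w : List Item) (u : ℕ) :
    sz (goto n x w u).1 ≤ sz u + sz (List.range n) ∧
      sz (goto n x w u).2 ≤ 1 + sz w * (sz w + sz (List.range n) + 2) := by
  have hr : ∀ z < n, sz z ≤ sz (List.range n) := fun z hz =>
    (sz_le_of_mem (List.mem_range.2 hz)).le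
  constructor
  · have : ∀ (l : List Item) s, sz s.2.1 ≤ sz u + sz (List.range n) →
        sz (l.foldl (gotoStep n x) s).2.1 ≤ sz u + sz (List.range n) := by
      intro l
      induction l with
      | nil => exact fun s hs => hs
      | cons it l ih =>
        intro s hs
        refine ih _ ?_
        rcases gotoStep_cases n x s it with ⟨h, -⟩ | ⟨z, hz, -, -, h⟩
        · rw [h]; exact hs
        · rw [h]; exact (hr z hz).trans (Nat.le_add_left _ _)
    exact this w (w, u, []) (Nat.le_add_right _ _)
  · have := foldl_measure_le (s := gotoStep n x) (fun s => sz s.2.2)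
      (sz w + sz (List.range n) + 2) w (fun s it hit => ?_) (w, u, [])
    · refine this.trans ?_
      have := Nat.mul_le_mul_right (sz w + sz (List.range n) + 2) (length_lt_sz w).le
      simp only [sz_nil]; omega
    · have h1 := sz_le_of_mem hit
      rcases gotoStep_cases n x s it with ⟨h, -⟩ | ⟨z, hz, -, -, h⟩
      · rw [h]; simp
      · have := hr z hz
        rw [h]; simp only [sz_cons, sz_prod] at *; omega

theorem assigned_eq_nil_or_mem (A : List (ℕ × List ℕ)) (p : ℕ) :
    assigned A p = [] ∨ (p, assigned A p) ∈ A := by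
  induction A using List.reverseRecOn with
  | nil => exact Or.inl rfl
  | append_singleton A e ih =>
    have : assigned (A ++ [e]) p = bif Nat.beq e.1 p then e.2 else assigned A p := by
      simp [assigned]
    rw [this]
    cases h : Nat.beq e.1 p with
    | true => right; rw [← Nat.eq_of_beq_eq_true h]; simp
    | false =>
      rcases ih with h | h
      · exact Or.inl h
      · exact Or.inr (List.mem_append_left _ h)

theorem sz_assigned_le (A : List (ℕ × List ℕ)) (p : ℕ) : sz (assigned A p) ≤ sz A := by
  rcases assigned_eq_nil_or_mem A p with h | h
  · rw [h]; exact one_le_sz A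
  · have := sz_le_of_mem h
    rw [sz_pair] at this; omega

namespace PT

variable {α : Type} [Enc α]

@[fun_prop] theorem tourFrom {n : α → ℕ} {w : α → List Item} {v : α → ℕ} (hn : PT n) (hw : PT w)
    (hv : PT v) : PT fun a => tourFrom (n a) (w a) (v a) := by
  refine foldl_of_growth (f := fun a => List.replicate (n a) ()) (i := fun a => [v a])
    (s := fun a t _ => TemporalExploration.extendTour (n a) (w a) t) (by fun_prop) (by fun_prop)
    (by fun_prop) (fun a t => ∀ x ∈ t, sz x ≤ sz (v a) + sz (List.range (n a)))
    (g := fun a => 2 * (sz (v a) + sz (List.range (n a))) + 2) (by fun_prop)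
    (fun a x hx => ?_) (fun a t _ _ ht => ?_) fun a t _ _ ht => ?_
  · rw [List.mem_singleton.1 hx]; exact Nat.le_add_right _ _
  · rcases extendTour_spec (n a) (w a) t with ⟨h, -⟩ | ⟨i, y, hi, hy, -, h, -⟩
    · rwa [h]
    · rw [h]
      intro x hx
      rcases List.mem_append.1 hx with hx | hx
      · exact ht x (List.mem_of_mem_take hx)
      · rcases List.mem_cons.1 hx with rfl | hx
        · have := sz_le_of_mem (List.mem_range.2 hy); omega
        · exact ht x (List.mem_of_mem_drop hx)
  · rcases extendTour_spec (n a) (w a) t with ⟨h, -⟩ | ⟨i, y, hi, hy, -, h, -⟩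
    · rw [h]; omega
    · rw [h, sz_extend hi]
      have := sz_le_of_mem (List.mem_range.2 hy)
      have := ht _ (List.getElem_mem hi)
      omega

@[fun_prop] theorem greedy {ph : α → List Phase} {S : α → List ℕ} (hp : PT ph) (hS : PT S) :
    PT fun a => greedy (ph a) (S a) := by
  refine foldl_of_growth (i := fun a => (S a, []))
    (s := fun a s _ => TemporalExploration.greedyStep (ph a) s) hp (by fun_prop)
    (by fun_prop) (fun a s => sz s.1 ≤ sz (S a))
    (g := fun a => sz (ph a) + sz (S a) + 2) (by fun_prop)
    (fun a => le_rfl) (fun a s _ _ hs => ?_) fun a s _ _ hs => ?_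
  · rcases greedyStep_cases (ph a) s with ⟨q, -, -, -, h, -⟩ | ⟨h, -⟩
    · rw [h]
      exact ((sz_tail_le _).trans (sz_sublist (run_suffix _ _).sublist)).trans hs
    · rwa [h]
  · rcases greedyStep_cases (ph a) s with ⟨q, hq, -, -, h, -⟩ | ⟨h, -⟩
    · have h1 := (sz_tail_le _).trans (sz_sublist (run_suffix q.2.2 s.1).sublist)
      have h2 := sz_le_of_mem hq
      rw [h]; simp only [sz_cons, sz_prod] at *; omega
    · rw [h]; omega

@[fun_prop] theorem goto {n x : α → ℕ} {w : α → List Item} {u : α → ℕ} (hn : PT n) (hx : PT x)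
    (hw : PT w) (hu : PT u) : PT fun a => goto (n a) (x a) (w a) (u a) := by
  refine snd (foldl_of_growth (i := fun a => (w a, u a, ([] : List (ℕ × ℕ))))
    (s := fun a s it => TemporalExploration.gotoStep (n a) (x a) s it) hw (by fun_prop)
    (by fun_prop) (fun _ _ => True) (g := fun a => sz (w a) + 2 * sz (List.range (n a)) + 2)
    (by fun_prop) (fun a => trivial) (fun _ _ _ _ _ => trivial) fun a s it hit _ => ?_)
  have h1 := sz_tail_le s.1
  have h2 := sz_le_of_mem hit
  rcases gotoStep_cases (n a) (x a) s it with ⟨h, -⟩ | ⟨z, hz, -, -, h⟩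
  · rw [h]; simp only [sz_prod] at *; omega
  · have := sz_le_of_mem (List.mem_range.2 hz)
    rw [h]; simp only [sz_cons, sz_prod] at *; omega

@[fun_prop] theorem travelStep {n : α → ℕ} {A : α → List (ℕ × List ℕ)} {s : α → ℕ × List (ℕ × ℕ)}
    {q : α → Phase} (hn : PT n) (hA : PT A) (hs : PT s) (hq : PT q) :
    PT fun a => travelStep (n a) (A a) (s a) (q a) := by
  unfold TemporalExploration.travelStep; fun_prop

-- The growth per phase must be additive. The moves recorded by `goto` are bounded independently of
-- the current vertex (`sz_goto_le`), and those of `run` by a polynomial in the sizes of the phases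
-- and of the assigned tours, neither of which changes during the fold.
@[fun_prop] theorem travel {n : α → ℕ} {A : α → List (ℕ × List ℕ)} {ph : α → List Phase}
    {v : α → ℕ} (hn : PT n) (hA : PT A) (hp : PT ph) (hv : PT v) :
    PT fun a => travel (n a) (A a) (ph a) (v a) := by
  obtain ⟨r, hr⟩ := (run (w := fun a : List Item × List ℕ => a.1) (S := fun a => a.2)
    (by fun_prop) (by fun_prop)).1
  refine foldl (i := fun a => (v a, ([] : List (ℕ × ℕ))))
    (s := fun a s q => TemporalExploration.travelStep (n a) (A a) s q) hp (by fun_prop)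
    (by fun_prop) (g := fun a => sz (A a) + sz (List.range (n a)) +
      (1 + sz (ph a) * (sz (ph a) + sz (List.range (n a)) + 2)) +
      r.eval (sz (ph a) + sz (A a))) (by fun_prop) fun a s q hq => ?_
  have hq := sz_le_of_mem hq
  have h1 := sz_assigned_le (A a) q.1
  have h2 := sz_goto_le (n a) ((TemporalExploration.assigned (A a) q.1).headD 0) q.2.1 s.1
  have h3 := (hr (q.2.2, TemporalExploration.assigned (A a) q.1)).trans
    (polynomial_eval_mono r (b := sz (ph a) + sz (A a)) (by
      simp only [sz_prod] at *; omega))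
  have h4 : sz q.2.1 ≤ sz (ph a) := by simp only [sz_prod] at *; omega
  have h5 := Nat.mul_le_mul h4 (by omega : sz q.2.1 + sz (List.range (n a)) + 2 ≤
    sz (ph a) + sz (List.range (n a)) + 2)
  set S := TemporalExploration.assigned (A a) q.1 with hS
  set g := TemporalExploration.goto (n a) (S.headD 0) q.2.1 s.1 with hg
  set R := TemporalExploration.run q.2.2 S with hR
  have h6 : sz (R.1.headD 0) ≤ sz (A a) :=
    ((sz_headD_le _).trans (sz_sublist (run_suffix _ _).sublist)).trans h1
  have h7 := sz_append g.2 s.2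
  have h8 := sz_append R.2 (g.2 ++ s.2)
  simp only [sz_prod, ← hR] at h3
  unfold TemporalExploration.travelStep
  simp only [← hS, ← hg, ← hR]
  cases S.isEmpty
  · cases Nat.beq g.1 (S.headD 0)
    · simp only [cond_false, sz_prod]; omega
    · simp only [cond_true, cond_false, sz_prod]; omega
  · simp

@[fun_prop] theorem plan {n v : α → ℕ} {ph : α → List Phase} (hn : PT n) (hv : PT v) (hp : PT ph) :
    PT fun a => plan (n a) (v a) (ph a) := by
  unfold TemporalExploration.plan; fun_prop

@[fun_prop] theorem visitsAll {n v : α → ℕ} {w : α → List (ℕ × ℕ)} (hn : PT n) (hv : PT v)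
    (hw : PT w) : PT fun a => visitsAll (n a) (v a) (w a) := by
  unfold TemporalExploration.visitsAll; fun_prop

theorem solve : PT solve := by
  obtain ⟨q, hq⟩ := (plan (n := fun a : (ℕ × ℕ × List Mat) × ℕ => a.1.1) (v := fun a => a.1.2.1)
    (ph := fun a => TemporalExploration.phases (TemporalExploration.timed a.1.2.2) a.2)
    (by fun_prop) (by fun_prop) (by fun_prop)).1
  refine foldl (f := fun x : ℕ × ℕ × List Mat => List.range (x.2.2.length + 1)) (i := fun _ => [])
    (s := fun x acc D => bif TemporalExploration.visitsAll x.1 x.2.1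
      (TemporalExploration.plan x.1 x.2.1
        (TemporalExploration.phases (TemporalExploration.timed x.2.2) D)) then
      TemporalExploration.plan x.1 x.2.1
        (TemporalExploration.phases (TemporalExploration.timed x.2.2) D) else acc)
    (by fun_prop) (by fun_prop) (by fun_prop)
    (g := fun x => q.eval (sz x + sz (List.range (x.2.2.length + 1)))) (by fun_prop)
    fun x c D hD => ?_
  have h := (hq (x, D)).trans (polynomial_eval_mono q (sz_pair_le_of_mem x hD))
  generalize TemporalExploration.visitsAll x.1 x.2.1 _ = b
  cases b
  · exact Nat.le_add_right _ _
  · exact h.trans (Nat.le_add_left _ _)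

end PT

/-! ## Planned walks are temporal walks -/

section Walks

variable {n L : ℕ} (G : TemporalGraph (Fin n) L)

open Classical in
/-- The adjacency matrices of the snapshots. -/
noncomputable def mats : List Mat :=
  List.ofFn fun t : Fin L => List.ofFn fun x : Fin n => List.ofFn fun y : Fin n =>
    decide ((G t).Adj x y)

/-- `x` and `y` are numbers of vertices that are adjacent at time `t`. -/
def AdjAt (t x y : ℕ) : Prop :=
  ∃ (ht : t < L) (hx : x < n) (hy : y < n), (G ⟨t, ht⟩).Adj ⟨x, hx⟩ ⟨y, hy⟩

variable {G} in
theorem AdjAt.symm {t x y : ℕ} : AdjAt G t x y → AdjAt G t y x :=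
  fun ⟨ht, hx, hy, h⟩ => ⟨ht, hy, hx, h.symm⟩

theorem headD_drop_ofFn {α : Type} {m : ℕ} (f : Fin m → α) (d : α) (i : ℕ) :
    ((List.ofFn f).drop i).headD d = if h : i < m then f ⟨i, h⟩ else d := by
  split_ifs with h
  · rw [headD_drop d (by simpa using h)]; simp
  · rw [List.drop_eq_nil_of_le (by simpa using h)]; rfl

theorem encodeInput_eq (v : Fin n) : encodeInput G v = enc (n, (v : ℕ), mats G) := by
  simp only [encodeInput, enc, mats, List.map_ofFn, Function.comp_def]

theorem length_mats : (mats G).length = L := by simp [mats]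

theorem length_timed : (timed (mats G)).length = L := by simp [timed, length_mats]

theorem fst_getElem_timed {Gs : List Mat} {t : ℕ} (h : t < (timed Gs).length) :
    (timed Gs)[t].1 = t := by
  simp [timed]

theorem adj_getElem_timed {t : ℕ} (h : t < (timed (mats G)).length) (x y : ℕ) :
    adj (timed (mats G))[t].2 x y = true ↔ AdjAt G t x y := by
  have ht : t < L := by rwa [length_timed] at h
  have h1 : (timed (mats G))[t].2 = ((mats G).drop t).headD [] := by simp [timed]
  rw [h1, mats, headD_drop_ofFn, dif_pos ht, adj, headD_drop_ofFn, AdjAt]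
  by_cases hx : x < n
  · rw [dif_pos hx, headD_drop_ofFn]
    by_cases hy : y < n
    · simp [hx, hy, ht]
    · simp [hy]
  · simp [hx]

theorem adj_of_mem_timed {it : Item} (h : it ∈ timed (mats G)) (x y : ℕ) :
    adj it.2 x y = true ↔ AdjAt G it.1 x y := by
  obtain ⟨t, ht, rfl⟩ := List.getElem_of_mem h
  rw [adj_getElem_timed, fst_getElem_timed]

/-- `mv` lists the moves of a temporal walk from `v` to `u` before time `T`, the last move first. -/
def RevWalk (v : ℕ) : ℕ → ℕ → List (ℕ × ℕ) → Prop
  | _, u, [] => u = v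
  | T, u, (t, y) :: mv => y = u ∧ t < T ∧ ∃ u', AdjAt G t u' u ∧ RevWalk v t u' mv

variable {G}

theorem RevWalk.mono {v T T' u : ℕ} {mv : List (ℕ × ℕ)} (h : RevWalk G v T u mv) (hT : T ≤ T') :
    RevWalk G v T' u mv := by
  match mv, h with
  | [], h => exact h
  | (t, y) :: mv, ⟨h1, h2, h3⟩ => exact ⟨h1, h2.trans_le hT, h3⟩

theorem RevWalk.lt {v T u : ℕ} {mv : List (ℕ × ℕ)} (h : RevWalk G v T u mv) (hv : v < n) :
    u < n := by
  match mv, h with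
  | [], h => exact h ▸ hv
  | (t, y) :: mv, ⟨_, _, _, ⟨_, _, hu, _⟩, _⟩ => exact hu

theorem RevWalk.visited {v T u : ℕ} {mv : List (ℕ × ℕ)} (h : RevWalk G v T u mv) :
    u ∈ v :: mv.map fun m => m.2 := by
  match mv, h with
  | [], h => simpa [RevWalk] using h
  | (t, y) :: mv, ⟨h, _⟩ => simp [h]

theorem isWalk_append_singleton {V : Type} {H : TemporalGraph V L} {v u : V} {t : Fin L}
    {w : List (Fin L × V)} (h : H.IsWalk v w) (ht : ∀ m ∈ w, m.1 < t)
    (hu : (H t).Adj (TemporalGraph.walkEnd v w) u) :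
    H.IsWalk v (w ++ [(t, u)]) ∧ TemporalGraph.walkEnd v (w ++ [(t, u)]) = u := by
  induction w generalizing v with
  | nil => simpa [TemporalGraph.IsWalk, TemporalGraph.walkEnd] using hu
  | cons m w ih =>
    obtain ⟨t', u'⟩ := m
    obtain ⟨h1, h2, h3⟩ := h
    obtain ⟨h4, h5⟩ := ih h3 (fun m hm => ht m (List.mem_cons_of_mem _ hm)) hu
    refine ⟨⟨h1, fun m hm => ?_, h4⟩, h5⟩
    rcases List.mem_append.1 hm with hm | hm
    · exact h2 m hm
    · rw [List.mem_singleton.1 hm]; exact ht _ List.mem_cons_self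

theorem RevWalk.exists_isWalk {v : Fin n} {T u : ℕ} {mv : List (ℕ × ℕ)} (h : RevWalk G v T u mv) :
    ∃ w : List (Fin L × Fin n), w.map (fun m => ((m.1 : ℕ), (m.2 : ℕ))) = mv.reverse ∧
      G.IsWalk v w ∧ (∀ m ∈ w, (m.1 : ℕ) < T) ∧ ((TemporalGraph.walkEnd v w : Fin n) : ℕ) = u := by
  induction mv generalizing T u with
  | nil => exact ⟨[], rfl, trivial, by simp, h.symm⟩
  | cons m mv ih =>
    obtain ⟨t, y⟩ := m
    obtain ⟨rfl, ht, u', ⟨htL, hu', hy, hadj⟩, h'⟩ := h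
    obtain ⟨w, h1, h2, h3, h4⟩ := ih h'
    have h5 : TemporalGraph.walkEnd v w = ⟨u', hu'⟩ := Fin.ext h4
    obtain ⟨h6, h7⟩ := isWalk_append_singleton (t := ⟨t, htL⟩) (u := ⟨y, hy⟩) h2
      (fun m hm => Fin.lt_def.2 (h3 m hm)) (by rw [h5]; exact hadj)
    refine ⟨_, by simp [h1], h6, fun m hm => ?_, by rw [h7]⟩
    rcases List.mem_append.1 hm with hm | hm
    · exact (h3 m hm).trans ht
    · rw [List.mem_singleton.1 hm]; exact ht

/-- The item at position `t` carries the time step `t`, so the time index of the invariant advances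
with the list; beyond the end of the list `hmono` takes over. -/
theorem foldl_segment {γ : Type} {I : List Item} (hI : ∀ t (h : t < I.length), I[t].1 = t)
    {s : γ → Item → γ} {Inv : ℕ → γ → Prop} (hmono : ∀ T c, Inv T c → Inv (T + 1) c)
    (hs : ∀ c, ∀ it ∈ I, Inv it.1 c → Inv (it.1 + 1) (s c it)) (a d : ℕ) (c : γ) (hc : Inv a c) :
    Inv (a + d) (((I.drop a).take d).foldl s c) := by
  induction d generalizing a c with
  | zero => simpa using hc
  | succ d ih =>
    rw [show a + (d + 1) = a + 1 + d by omega]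
    by_cases ha : a < I.length
    · rw [List.drop_eq_getElem_cons ha, List.take_succ_cons, List.foldl_cons]
      refine ih _ _ ?_
      have := hs c I[a] (List.getElem_mem ha) (by rwa [hI])
      rwa [hI] at this
    · have h1 := ih (a + 1) c (hmono _ _ hc)
      rw [List.drop_eq_nil_of_le (by omega)] at h1 ⊢
      simpa using h1

/-- Recorded moves never influence the behaviour of the agent, so earlier ones are merely carried
along. -/
theorem foldl_runStep (w : List Item) (S : List ℕ) (mv : List (ℕ × ℕ)) :
    w.foldl runStep (S, mv) = ((run w S).1, (run w S).2 ++ mv) := by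
  have : ∀ (w : List Item) (s : List ℕ × List (ℕ × ℕ)),
      w.foldl runStep (s.1, s.2 ++ mv) = ((w.foldl runStep s).1, (w.foldl runStep s).2 ++ mv) := by
    intro w
    induction w with
    | nil => intro s; rfl
    | cons it w ih =>
      intro s
      rw [List.foldl_cons, List.foldl_cons, ← ih]
      congr 1
      unfold runStep
      dsimp only
      cases !s.1.tail.isEmpty && _ <;> rfl
  exact this w (S, [])

theorem foldl_gotoStep (n x : ℕ) (w : List Item) (u : ℕ) (mv : List (ℕ × ℕ)) :
    (w.foldl (gotoStep n x) (w, u, mv)).2 = ((goto n x w u).1, (goto n x w u).2 ++ mv) := by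
  have : ∀ (w : List Item) (s : List Item × ℕ × List (ℕ × ℕ)),
      w.foldl (gotoStep n x) (s.1, s.2.1, s.2.2 ++ mv) =
        ((w.foldl (gotoStep n x) s).1, (w.foldl (gotoStep n x) s).2.1,
          (w.foldl (gotoStep n x) s).2.2 ++ mv) := by
    intro w
    induction w with
    | nil => intro s; rfl
    | cons it w ih =>
      intro s
      rw [List.foldl_cons, List.foldl_cons, ← ih]
      congr 1
      unfold gotoStep
      dsimp only
      cases (back n x s.1.tail).contains s.2.1 || _ <;> rfl
  have h := this w (w, u, [])
  rw [List.nil_append] at h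
  rw [h]
  rfl

theorem RevWalk.run {v : ℕ} {S : List ℕ} {a d : ℕ} {mv : List (ℕ × ℕ)}
    (h : RevWalk G v a (S.headD 0) mv) :
    RevWalk G v (a + d) ((run (((timed (mats G)).drop a).take d) S).1.headD 0)
      ((run (((timed (mats G)).drop a).take d) S).2 ++ mv) := by
  have := foldl_segment (I := timed (mats G)) (s := runStep) (fun t h => fst_getElem_timed h)
    (Inv := fun T s => RevWalk G v T (s.1.headD 0) s.2) (fun T c hc => hc.mono (Nat.le_succ T))
    (fun s it hit hs => ?_) a d (S, mv) h
  · rwa [foldl_runStep] at this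
  · rcases runStep_cases s it with ⟨x, y, l, h1, h2, h3⟩ | ⟨h, -⟩
    · rw [h3]
      rw [h1] at hs
      exact ⟨rfl, Nat.lt_succ_self _, x, (adj_of_mem_timed G hit x y).1 h2, hs⟩
    · rw [h]; exact hs.mono (Nat.le_succ _)

theorem RevWalk.goto {v x u : ℕ} {a d : ℕ} {mv : List (ℕ × ℕ)} (h : RevWalk G v a u mv) :
    RevWalk G v (a + d) (goto n x (((timed (mats G)).drop a).take d) u).1
      ((goto n x (((timed (mats G)).drop a).take d) u).2 ++ mv) := by
  have := foldl_segment (I := timed (mats G)) (s := gotoStep n x) (fun t h => fst_getElem_timed h)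
    (Inv := fun T s => RevWalk G v T s.2.1 s.2.2) (fun T c hc => hc.mono (Nat.le_succ T))
    (fun s it hit hs => ?_) a d (((timed (mats G)).drop a).take d, u, mv) h
  · rwa [foldl_gotoStep] at this
  · rcases gotoStep_cases n x s it with ⟨h, -⟩ | ⟨z, -, h2, -, h3⟩
    · rw [h]; exact hs.mono (Nat.le_succ _)
    · rw [h3]
      exact ⟨rfl, Nat.lt_succ_self _, _, (adj_of_mem_timed G hit _ _).1 h2, hs⟩

/-- The phase with number `p`. -/
def phaseAt (I : List Item) (D p : ℕ) : Phase :=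
  (p, (I.drop (p * (D + D))).take D, (I.drop (p * (D + D) + D)).take D)

theorem RevWalk.travelStep {v D p : ℕ} (A : List (ℕ × List ℕ)) {s : ℕ × List (ℕ × ℕ)}
    (h : RevWalk G v (p * (D + D)) s.1 s.2) :
    RevWalk G v ((p + 1) * (D + D)) (TemporalExploration.travelStep n A s (phaseAt (timed (mats G)) D p)).1
      (TemporalExploration.travelStep n A s (phaseAt (timed (mats G)) D p)).2 := by
  have h1 := RevWalk.goto (x := (assigned A p).headD 0) (d := D) h
  have e : (p + 1) * (D + D) = p * (D + D) + D + D := by ring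
  unfold TemporalExploration.travelStep phaseAt
  dsimp only
  cases (assigned A p).isEmpty
  · cases hb : Nat.beq _ ((assigned A p).headD 0)
    · exact h1.mono (by omega)
    · rw [Nat.eq_of_beq_eq_true hb] at h1
      have h2 := RevWalk.run (d := D) h1
      rw [← e] at h2
      exact h2
  · exact h.mono (by omega)

theorem phases_eq (I : List Item) (D : ℕ) : phases I D =
    ((List.range (I.length + 1)).filter fun p => Nat.ble ((p + 1) * (D + D)) I.length).map
      (phaseAt I D) := rfl

theorem revWalk_foldl_travelStep {v D : ℕ} (A : List (ℕ × List ℕ)) {ps : List ℕ}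
    (hps : ps.Pairwise (· < ·)) {T B : ℕ} (hT : ∀ p ∈ ps, T ≤ p * (D + D)) (hTB : T ≤ B)
    (hB : ∀ p ∈ ps, (p + 1) * (D + D) ≤ B) {s : ℕ × List (ℕ × ℕ)} (h : RevWalk G v T s.1 s.2) :
    RevWalk G v B ((ps.map (phaseAt (timed (mats G)) D)).foldl (travelStep n A) s).1
      ((ps.map (phaseAt (timed (mats G)) D)).foldl (travelStep n A) s).2 := by
  induction ps generalizing T s with
  | nil => exact h.mono hTB
  | cons p ps ih =>
    obtain ⟨h1, h2⟩ := List.pairwise_cons.1 hps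
    exact ih h2 (T := (p + 1) * (D + D)) (fun q hq => Nat.mul_le_mul_right _ (h1 q hq))
      (hB p List.mem_cons_self) (fun q hq => hB q (List.mem_cons_of_mem _ hq))
      (RevWalk.travelStep A (h.mono (hT p List.mem_cons_self)))

theorem pairwise_phase_numbers (I : List Item) (D : ℕ) :
    ((List.range (I.length + 1)).filter fun p =>
      Nat.ble ((p + 1) * (D + D)) I.length).Pairwise (· < ·) :=
  (List.pairwise_lt_range).sublist List.filter_sublist

theorem exists_revWalk_plan (v : ℕ) (D : ℕ) :
    ∃ T u, RevWalk G v T u (plan n v (phases (timed (mats G)) D)).reverse := by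
  have h := revWalk_foldl_travelStep (G := G) (v := v) (D := D) (s := (v, []))
    (greedy (phases (timed (mats G)) D) (tourFrom n ((phases (timed (mats G)) D).flatMap
      fun q => q.2.2) v)).2 (pairwise_phase_numbers (timed (mats G)) D) (T := 0)
    (B := (timed (mats G)).length) (fun _ _ => Nat.zero_le _) (Nat.zero_le _)
    (fun p hp => by simpa using (List.mem_filter.1 hp).2) rfl
  exact ⟨_, _, by rw [plan, List.reverse_reverse]; exact h⟩

theorem solve_cases (x : ℕ × ℕ × List Mat) :
    (∃ D, visitsAll x.1 x.2.1 (plan x.1 x.2.1 (phases (timed x.2.2) D)) = true ∧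
      solve x = plan x.1 x.2.1 (phases (timed x.2.2) D)) ∨
    ∀ D ≤ x.2.2.length, visitsAll x.1 x.2.1 (plan x.1 x.2.1 (phases (timed x.2.2) D)) = false := by
  unfold solve
  have : ∀ l : List ℕ, (∃ D, visitsAll x.1 x.2.1 (plan x.1 x.2.1 (phases (timed x.2.2) D)) = true ∧
      l.foldl (fun acc D => bif visitsAll x.1 x.2.1 (plan x.1 x.2.1 (phases (timed x.2.2) D)) then
        plan x.1 x.2.1 (phases (timed x.2.2) D) else acc) [] =
        plan x.1 x.2.1 (phases (timed x.2.2) D)) ∨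
      ∀ D ∈ l, visitsAll x.1 x.2.1 (plan x.1 x.2.1 (phases (timed x.2.2) D)) = false := by
    intro l
    induction l using List.reverseRecOn with
    | nil => right; simp
    | append_singleton l D ih =>
      rw [List.foldl_append, List.foldl_cons, List.foldl_nil]
      cases h : visitsAll x.1 x.2.1 (plan x.1 x.2.1 (phases (timed x.2.2) D)) with
      | true => exact Or.inl ⟨D, h, rfl⟩
      | false =>
        rcases ih with ih | ih
        · exact Or.inl ih
        · right
          intro D' hD'
          rcases List.mem_append.1 hD' with hD' | hD'
          · exact ih D' hD'
          · rwa [List.mem_singleton.1 hD']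
  refine (this _).imp_right fun h D hD => h D (List.mem_range.2 (by omega))

/-- The algorithm finds an exploration schedule if some `D` leads to one. -/
theorem isScheduleCode_solve {v : Fin n} {D : ℕ} (hD : D ≤ L)
    (h : visitsAll n v (plan n v (phases (timed (mats G)) D)) = true) :
    IsScheduleCode G v (enc (solve (n, (v : ℕ), mats G))) := by
  rcases solve_cases (n, (v : ℕ), mats G) with ⟨D', h1, h2⟩ | h'
  -- Whichever `D'` produced the output, its plan is a temporal walk; the hypothesis `h` only
  -- ensures that some candidate passes the test.
  · obtain ⟨T, u, hw⟩ := exists_revWalk_plan (G := G) v D'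
    obtain ⟨w, h3, h4, -, -⟩ := hw.exists_isWalk
    rw [List.reverse_reverse] at h3
    refine ⟨w, ?_, h4, fun x => ?_⟩
    · rw [h2, ← h3]
      simp only [encodeWalk, enc, List.map_map]
      rfl
    · have h5 := List.all_eq_true.1 h1 x (List.mem_range.2 x.2)
      rw [← h3] at h5
      simp only [List.map_map, List.contains_iff_mem, List.mem_cons, List.mem_map,
        Function.comp_def] at h5 ⊢
      rcases h5 with h5 | ⟨m, hm, h5⟩
      · exact Or.inl (Fin.ext h5)
      · exact Or.inr ⟨m, hm, Fin.ext h5⟩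
  · rw [h' D (by simpa [length_mats] using hD)] at h
    exact absurd h Bool.false_ne_true

end Walks

/-! ## The planned walk visits what is assigned to the phases -/

theorem mem_back_cons {n x y : ℕ} {it : Item} {w : List Item} : y ∈ back n x (it :: w) ↔
    y < n ∧ (y ∈ back n x w ∨ ∃ z ∈ back n x w, adj it.2 y z = true) := by
  have : back n x (it :: w) = (List.range n).filter fun y =>
      (back n x w).contains y || (back n x w).any fun z => adj it.2 y z := by
    simp [back]
  rw [this]
  simp

theorem lt_of_mem_back {n x y : ℕ} (hx : x < n) {w : List Item} (h : y ∈ back n x w) : y < n := by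
  cases w with
  | nil =>
    have : y = x := by simpa [back] using h
    omega
  | cons it w => exact (mem_back_cons.1 h).1

theorem mem_back_of_mem_drop {n x y : ℕ} (hx : x < n) {w : List Item} (i : ℕ)
    (h : y ∈ back n x (w.drop i)) : y ∈ back n x w := by
  induction i generalizing w with
  | zero => exact h
  | succ i ih =>
    cases w with
    | nil => exact h
    | cons it w =>
      have := ih (w := w) h
      exact mem_back_cons.2 ⟨lt_of_mem_back hx this, Or.inl this⟩

theorem mem_back_self {n x : ℕ} (hx : x < n) (w : List Item) : x ∈ back n x w :=
  mem_back_of_mem_drop hx w.length (by simp [back])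

/-- The invariant is that the current vertex lies in `back` of the remaining snapshots. If waiting
would destroy it, `mem_back_cons` supplies a neighbour to move to; once no snapshot remains, it says
that the vertex is `x`. -/
theorem goto_fst_of_mem_back {n x u : ℕ} (hx : x < n) {w : List Item} (h : u ∈ back n x w) :
    (goto n x w u).1 = x := by
  have : ∀ (w : List Item) u mv, u ∈ back n x w →
      (w.foldl (gotoStep n x) (w, u, mv)).2.1 = x := by
    intro w
    induction w with
    | nil => intro u mv h; simpa [back] using h
    | cons it w ih =>
      intro u mv h
      rw [List.foldl_cons]
      rcases gotoStep_cases n x (it :: w, u, mv) it with ⟨h1, h2⟩ | ⟨z, -, -, hz, h1⟩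
      · rw [h1]
        refine ih u mv (h2.elim id fun h2 => ?_)
        rcases (mem_back_cons.1 h).2 with h3 | ⟨z, hz, ha⟩
        · exact h3
        · exact absurd hz (h2 z (lt_of_mem_back hx hz) ha)
      · rw [h1]
        exact ih z _ hz
  exact this w u [] h

/-- Induction along the walk; `j` records from which snapshot on the rest of the walk takes place,
as its first move at time `t` leaves `W.drop (t + 1)` for the others. -/
theorem mem_back_of_isWalk {n d : ℕ} {H : TemporalGraph (Fin n) d} {W : List Item} (hd : d ≤ W.length)
    (hW : ∀ (i : Fin d) (x y : Fin n), (H i).Adj x y → adj (W[(i : ℕ)]'(by omega)).2 x y = true)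
    {x : Fin n} (w : List (Fin d × Fin n)) (u : Fin n) (hw : H.IsWalk u w)
    (hx : TemporalGraph.walkEnd u w = x) (j : ℕ) (hj : ∀ m ∈ w, j ≤ m.1) :
    (u : ℕ) ∈ back n x (W.drop j) := by
  induction w generalizing u j with
  | nil => rw [show u = x from hx]; exact mem_back_self x.2 _
  | cons m w ih =>
    obtain ⟨t, y⟩ := m
    obtain ⟨h1, h2, h3⟩ := hw
    have h4 := ih y h3 hx (t + 1) fun m hm => h2 m hm
    have h5 : (u : ℕ) ∈ back n x (W.drop t) := by
      rw [List.drop_eq_getElem_cons (by omega)]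
      exact mem_back_cons.2 ⟨u.2, Or.inr ⟨y, h4, hW t u y h1⟩⟩
    have h6 : j ≤ t := hj _ List.mem_cons_self
    apply mem_back_of_mem_drop x.2 (t - j)
    rwa [List.drop_drop, Nat.add_sub_cancel' h6]

/-- Within `Δ` time steps every vertex is reached. -/
theorem goto_fst {n L Δ D a : ℕ} {G : TemporalGraph (Fin n) L} (hG : G.DeltaTemporallyConnected Δ)
    (hD : Δ ≤ D) (ha : a + D ≤ L) {x u : ℕ} (hx : x < n) (hu : u < n) :
    (goto n x (((timed (mats G)).drop a).take D) u).1 = x := by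
  obtain ⟨w, hw, hwx⟩ := hG a (by omega) ⟨u, hu⟩ ⟨x, hx⟩
  have hlen : (((timed (mats G)).drop a).take D).length = D := by
    rw [List.length_take, List.length_drop, length_timed]; omega
  refine goto_fst_of_mem_back hx ?_
  refine mem_back_of_isWalk (x := ⟨x, hx⟩) (by omega) (fun i y z h => ?_) w ⟨u, hu⟩ hw hwx 0
    fun _ _ => Nat.zero_le _
  have : (((timed (mats G)).drop a).take D)[(i : ℕ)]'(by omega) =
      (timed (mats G))[a + i]'(by rw [length_timed]; omega) := by
    rw [List.getElem_take, List.getElem_drop]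
  rw [this, adj_getElem_timed]
  exact ⟨by omega, y.2, z.2, h⟩

/-- An agent that follows a tour visits all vertices up to the one where it ends. -/
theorem run_visits {w : List Item} {S pre : List ℕ} (h : S = pre ++ (run w S).1.tail) {x : ℕ}
    (hx : x ∈ pre) : x ∈ S.headD 0 :: (run w S).2.map fun m => m.2 := by
  have key : ∀ (w : List Item) (s : List ℕ × List (ℕ × ℕ)),
      (∃ p, S = p ++ s.1.tail ∧ ∀ x ∈ p, x ∈ S.headD 0 :: s.2.map fun m => m.2) →
      ∃ p, S = p ++ (w.foldl runStep s).1.tail ∧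
        ∀ x ∈ p, x ∈ S.headD 0 :: (w.foldl runStep s).2.map fun m => m.2 := by
    intro w
    induction w with
    | nil => exact fun s h => h
    | cons it w ih =>
      intro s ⟨p, h1, h2⟩
      refine ih _ ?_
      rcases runStep_cases s it with ⟨y, z, l, h3, -, h4⟩ | ⟨h3, -⟩
      · rw [h4]
        refine ⟨p ++ [z], by rw [h1, h3]; simp, fun x hx => ?_⟩
        rcases List.mem_append.1 hx with hx | hx
        · rcases List.mem_cons.1 (h2 x hx) with h | h
          · rw [h]; exact List.mem_cons_self
          · exact List.mem_cons_of_mem _ (List.mem_cons_of_mem _ h)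
        · simp [List.mem_singleton.1 hx]
      · rw [h3]; exact ⟨p, h1, h2⟩
  obtain ⟨p, h1, h2⟩ := key w (S, []) (by
    cases S with
    | nil => exact ⟨[], rfl, by simp⟩
    | cons y l => exact ⟨[y], rfl, by simp⟩)
  have : pre = p := List.append_cancel_right (h.symm.trans h1)
  exact h2 x (this ▸ hx)

theorem travelStep_suffix (n : ℕ) (A : List (ℕ × List ℕ)) (s : ℕ × List (ℕ × ℕ)) (q : Phase) :
    s.2 <:+ (travelStep n A s q).2 := by
  unfold travelStep
  cases (assigned A q.1).isEmpty
  · cases Nat.beq _ ((assigned A q.1).headD 0)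
    · exact List.suffix_append _ _
    · exact (List.suffix_append _ _).trans (List.suffix_append _ _)
  · exact List.suffix_rfl

theorem foldl_travelStep_suffix (n : ℕ) (A : List (ℕ × List ℕ)) (ph : List Phase)
    (s : ℕ × List (ℕ × ℕ)) : s.2 <:+ (ph.foldl (travelStep n A) s).2 := by
  induction ph generalizing s with
  | nil => exact List.suffix_rfl
  | cons q ph ih => exact (travelStep_suffix n A s q).trans (ih _)

theorem mem_phases {I : List Item} {D : ℕ} {q : Phase} (h : q ∈ phases I D) :
    ∃ p, (p + 1) * (D + D) ≤ I.length ∧ q = phaseAt I D p := by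
  rw [phases_eq] at h
  obtain ⟨p, hp, rfl⟩ := List.mem_map.1 h
  have := (List.mem_filter.1 hp).2
  rw [Nat.ble_eq] at this
  exact ⟨p, this, rfl⟩

/-- The earlier phases form a walk that is over when phase `p` begins. Then `goto_fst` brings the
agent to the head of the assigned piece, `run_visits` covers `pre`, and the later phases only add
moves. -/
theorem travel_visits {n L Δ D v : ℕ} {G : TemporalGraph (Fin n) L}
    (hG : G.DeltaTemporallyConnected Δ) (hD : Δ ≤ D) (hv : v < n) {A : List (ℕ × List ℕ)}
    {q : Phase} (hq : q ∈ phases (timed (mats G)) D) (hne : assigned A q.1 ≠ [])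
    (hlt : (assigned A q.1).headD 0 < n)
    {pre : List ℕ} (hpre : assigned A q.1 = pre ++ (run q.2.2 (assigned A q.1)).1.tail) {x : ℕ}
    (hx : x ∈ pre) :
    x ∈ v :: (travel n A (phases (timed (mats G)) D) v).2.map fun m => m.2 := by
  obtain ⟨p, hp, rfl⟩ := mem_phases hq
  have hp' : p ∈ (List.range ((timed (mats G)).length + 1)).filter fun p =>
      Nat.ble ((p + 1) * (D + D)) (timed (mats G)).length := by
    rw [phases_eq] at hq
    obtain ⟨p', h1, h2⟩ := List.mem_map.1 hq
    rwa [← show p' = p from congrArg Prod.fst h2]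
  rw [travel, phases_eq]
  obtain ⟨l₁, l₂, hl⟩ := List.append_of_mem hp'
  have hsorted := pairwise_phase_numbers (timed (mats G)) D
  rw [hl] at hsorted ⊢
  rw [List.map_append, List.map_cons, List.foldl_append, List.foldl_cons]
  have hT := revWalk_foldl_travelStep (G := G) (v := v) (D := D) (s := (v, [])) A
    (List.pairwise_append.1 hsorted).1 (T := 0) (B := p * (D + D)) (fun _ _ => Nat.zero_le _)
    (Nat.zero_le _) (fun p' hp' => Nat.mul_le_mul_right _
      ((List.pairwise_append.1 hsorted).2.2 p' hp' p List.mem_cons_self)) rfl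
  set s := (l₁.map (phaseAt (timed (mats G)) D)).foldl (travelStep n A) (v, []) with hs
  have hgoto : (goto n ((assigned A p).headD 0) (((timed (mats G)).drop (p * (D + D))).take D)
      s.1).1 = (assigned A p).headD 0 := by
    refine goto_fst hG hD ?_ hlt (hT.lt hv)
    have : (p + 1) * (D + D) = p * (D + D) + D + D := by ring
    rw [length_timed] at hp
    omega
  have hstep : travelStep n A s (phaseAt (timed (mats G)) D p) =
      ((run (((timed (mats G)).drop (p * (D + D) + D)).take D) (assigned A p)).1.headD 0,
        (run (((timed (mats G)).drop (p * (D + D) + D)).take D) (assigned A p)).2 ++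
        ((goto n ((assigned A p).headD 0) (((timed (mats G)).drop (p * (D + D))).take D) s.1).2 ++
          s.2)) := by
    unfold travelStep phaseAt
    dsimp only
    rw [hgoto]
    have h1 : (assigned A p).isEmpty = false := by
      simpa using (show assigned A p ≠ [] from hne)
    have h2 : Nat.beq ((assigned A p).headD 0) ((assigned A p).headD 0) = true := by simp
    rw [h1, h2]
    rfl
  have hvis : (assigned A p).headD 0 ∈ v :: ((goto n ((assigned A p).headD 0)
      (((timed (mats G)).drop (p * (D + D))).take D) s.1).2 ++ s.2).map fun m => m.2 := by
    have := (hT.goto (x := (assigned A p).headD 0) (d := D)).visited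
    rwa [hgoto] at this
  have hmem := run_visits hpre hx
  have hsuf := foldl_travelStep_suffix n A (l₂.map (phaseAt (timed (mats G)) D))
    (travelStep n A s (phaseAt (timed (mats G)) D p))
  rw [hstep] at hsuf ⊢
  obtain ⟨r, hr⟩ := hsuf
  rw [← hr]
  change x ∈ (assigned A p).headD 0 ::
    (run (((timed (mats G)).drop (p * (D + D) + D)).take D) (assigned A p)).2.map _ at hmem
  simp only [List.map_append, List.mem_cons, List.mem_append] at hmem hvis ⊢
  rcases hmem with h | h
  · rw [h]
    rcases hvis with h' | h' <;> tauto
  · tauto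

/-! ## The greedy distribution of a tour over the phases -/

theorem suffix_tail_of_suffix {α : Type} {l l' : List α} (h : l <:+ l') : l.tail <:+ l'.tail := by
  obtain ⟨p, rfl⟩ := h
  cases p with
  | nil => exact List.suffix_rfl
  | cons a p => exact (List.tail_suffix l).trans (List.suffix_append p l)

/-- An agent that is behind cannot overtake: at equal positions both agents do the same, and a
strict lead is at least one vertex, which is as much as one step can gain. -/
theorem runStep_mono {s s' : List ℕ × List (ℕ × ℕ)} (h : s.1 <:+ s'.1) (it : Item) :
    (runStep s it).1 <:+ (runStep s' it).1 := by
  by_cases he : s.1 = s'.1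
  · have : ∀ s : List ℕ × List (ℕ × ℕ), (runStep s it).1 =
        bif !s.1.tail.isEmpty && adj it.2 (s.1.headD 0) (s.1.tail.headD 0) then s.1.tail else s.1 := by
      intro s
      unfold runStep
      cases !s.1.tail.isEmpty && _ <;> rfl
    rw [this, this, he]
  · have ht : s.1 <:+ s'.1.tail := by
      cases hs : s'.1 with
      | nil => rw [hs] at h he; exact absurd (List.suffix_nil.1 h) he
      | cons a l =>
        rw [hs] at h he
        exact (List.suffix_cons_iff.1 h).resolve_left he
    refine (runStep_suffix s it).trans ?_
    rcases runStep_cases s' it with ⟨x, y, l, h1, -, h2⟩ | ⟨h1, -⟩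
    · rw [h2]; rwa [h1] at ht
    · rw [h1]; exact h

theorem run_mono (w : List Item) {S S' : List ℕ} (h : S <:+ S') : (run w S).1 <:+ (run w S').1 := by
  have : ∀ (w : List Item) (s s' : List ℕ × List (ℕ × ℕ)), s.1 <:+ s'.1 →
      (w.foldl runStep s).1 <:+ (w.foldl runStep s').1 := by
    intro w
    induction w with
    | nil => exact fun _ _ h => h
    | cons it w ih => exact fun s s' h => ih _ _ (runStep_mono h it)
  exact this w (S, []) (S', []) h

/-- The sum of the costs of consecutive elements. -/
def cost (m : ℕ → ℕ → ℕ) : List ℕ → ℕ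
  | x :: y :: l => m x y + cost m (y :: l)
  | _ => 0

theorem cost_cons_le (m : ℕ → ℕ → ℕ) (x : ℕ) (l : List ℕ) : cost m l ≤ cost m (x :: l) := by
  cases l with
  | nil => simp [cost]
  | cons y l => simp [cost]

theorem cost_suffix_le (m : ℕ → ℕ → ℕ) {l l' : List ℕ} (h : l <:+ l') : cost m l ≤ cost m l' := by
  obtain ⟨p, rfl⟩ := h
  induction p with
  | nil => exact le_rfl
  | cons x p ih => exact ih.trans (cost_cons_le m x _)

theorem cost_add (m m' : ℕ → ℕ → ℕ) (l : List ℕ) :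
    cost (fun x y => m x y + m' x y) l = cost m l + cost m' l := by
  induction l with
  | nil => rfl
  | cons x l ih =>
    cases l with
    | nil => rfl
    | cons y l => simp only [cost] at *; omega

theorem miss_cons (it : Item) (w : List Item) (x y : ℕ) :
    miss (it :: w) x y = (bif adj it.2 x y then 0 else 1) + miss w x y := by
  unfold miss
  cases h : adj it.2 x y <;> simp [h, Nat.add_comm]

theorem miss_append (w w' : List Item) (x y : ℕ) : miss (w ++ w') x y = miss w x y + miss w' x y := by
  simp [miss]

/-- The number of vertices of a tour plus the number of times at which edges of it are missing. -/
def potential (w : List Item) (S : List ℕ) : ℕ := S.length + cost (miss w) S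

/-- A time step either advances, which shortens the tour, or waits at an edge missing at that time.
The edge waited at is not part of the final `tail`, so this miss counts for `S` but not for what
remains. Idling at the end of the tour is excluded because the final `tail` is nonempty. -/
theorem potential_run {w : List Item} {S : List ℕ} (h : (run w S).1.tail ≠ []) :
    potential w (run w S).1.tail + w.length ≤ potential w S := by
  have : ∀ (w : List Item) (s : List ℕ × List (ℕ × ℕ)), (w.foldl runStep s).1.tail ≠ [] →
      (w.foldl runStep s).1.tail.length + cost (miss w) (w.foldl runStep s).1.tail + w.length ≤
        s.1.length + cost (miss w) s.1 := by
    intro w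
    induction w with
    | nil =>
      intro s _
      have := cost_suffix_le (miss []) (List.tail_suffix s.1)
      have := (List.tail_suffix s.1).length_le
      simp only [List.foldl_nil, List.length_nil]; omega
    | cons it w ih =>
      intro s hs
      rw [List.foldl_cons] at hs ⊢
      have h1 := ih _ hs
      have hm : ∀ l, cost (miss (it :: w)) l =
          cost (fun x y => bif adj it.2 x y then 0 else 1) l + cost (miss w) l := fun l => by
        rw [← cost_add]; congr 1; funext x y; exact miss_cons it w x y
      have hsuf := foldl_runStep_suffix w (runStep s it)
      rw [hm, hm, List.length_cons]
      rcases runStep_cases s it with ⟨x, y, l, h2, -, h3⟩ | ⟨h2, h3⟩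
      · rw [h3] at hs h1 hsuf ⊢
        have h4 := cost_suffix_le (fun x y => bif adj it.2 x y then 0 else 1)
          ((List.tail_suffix _).trans (hsuf.trans (List.suffix_cons x _)))
        have h5 := cost_cons_le (miss w) x (y :: l)
        rw [h2]
        simp only [List.length_cons] at *; omega
      · rw [h2] at hs h1 hsuf ⊢
        match hS : s.1 with
        | [] => rw [hS] at hsuf; rw [List.suffix_nil.1 hsuf] at hs; simp at hs
        | [x] =>
          rw [hS] at hsuf
          have h4 := suffix_tail_of_suffix hsuf
          exact absurd (List.suffix_nil.1 h4) hs
        | x :: y :: l =>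
          rw [hS] at hsuf h1
          have h4 := cost_suffix_le (fun x y => bif adj it.2 x y then 0 else 1)
            (suffix_tail_of_suffix hsuf)
          have h5 := h3 x y l hS
          simp only [List.tail_cons] at h4
          simp only [cost, h5, cond_false] at *; omega
  exact this w (S, []) h

theorem mul_length_le_potential {w : List Item} {S : List ℕ} (j : ℕ)
    (h : (fun S => (run w S).1.tail)^[j] S ≠ []) :
    potential w ((fun S => (run w S).1.tail)^[j] S) + j * w.length ≤ potential w S := by
  induction j with
  | zero => simp
  | succ j ih =>
    rw [Function.iterate_succ_apply'] at h ⊢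
    have h1 := potential_run h
    have h2 := ih fun h0 => by
      rw [h0] at h
      have := (run_suffix w []).length_le
      simp only [List.length_nil, nonpos_iff_eq_zero, List.length_eq_zero_iff] at this
      rw [this] at h; exact h rfl
    rw [Nat.add_mul]; omega

theorem mem_assigned {A : List (ℕ × List ℕ)} {p : ℕ} (h : p ∈ A.map Prod.fst) :
    (p, assigned A p) ∈ A := by
  induction A using List.reverseRecOn with
  | nil => simp at h
  | append_singleton A e ih =>
    have h1 : assigned (A ++ [e]) p = bif Nat.beq e.1 p then e.2 else assigned A p := by
      simp [assigned]
    rw [h1]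
    cases h2 : Nat.beq e.1 p with
    | true => rw [← Nat.eq_of_beq_eq_true h2]; simp
    | false =>
      have h3 : e.1 ≠ p := Nat.ne_of_beq_eq_false h2
      rw [List.map_append, List.mem_append] at h
      refine List.mem_append_left _ (ih (h.resolve_right fun h4 => h3 ?_))
      simpa [eq_comm] using h4

/-- What the greedy algorithm guarantees for its state after `j` steps. -/
structure GreedyInv (ph : List Phase) (t : List ℕ) (j : ℕ) (s : List ℕ × List (ℕ × List ℕ)) :
    Prop where
  covered : ∃ l, t = l ++ s.1 ∧ ∀ x ∈ l, ∃ q ∈ ph, ∃ S pre, (q.1, S) ∈ s.2 ∧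
    S = pre ++ (run q.2.2 S).1.tail ∧ x ∈ pre
  nodup : (s.2.map Prod.fst).Nodup
  valid : ∀ e ∈ s.2, e.2 ≠ [] ∧ e.2 <:+ t
  -- Comparison with a fictitious agent that repeats one free phase `j` times.
  suffix : s.1 ≠ [] → ∀ q ∈ ph, q.1 ∉ s.2.map Prod.fst →
    s.1 <:+ (fun S => (run q.2.2 S).1.tail)^[j] t
  length_le : s.2.length ≤ j

namespace GreedyInv

variable {ph : List Phase} {t : List ℕ} {j : ℕ} {s : List ℕ × List (ℕ × List ℕ)}

theorem assigned_eq (h : GreedyInv ph t j s) {p : ℕ} {S : List ℕ} (hS : (p, S) ∈ s.2) :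
    assigned s.2 p = S := by
  have h1 := mem_assigned (List.mem_map_of_mem (f := Prod.fst) hS)
  exact congrArg Prod.snd (List.inj_on_of_nodup_map h.nodup h1 hS rfl)

theorem assigned_eq_nil (h : GreedyInv ph t j s) {p : ℕ} :
    assigned s.2 p = [] ↔ p ∉ s.2.map Prod.fst := by
  constructor
  · intro h1 h2
    exact (h.valid _ (mem_assigned h2)).1 h1
  · intro h1
    rcases assigned_eq_nil_or_mem s.2 p with h2 | h2
    · exact h2
    · exact absurd (List.mem_map_of_mem (f := Prod.fst) h2) h1

/-- A free phase `q'` was also available to the greedy choice, which gets at least as far on the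
current rest as `q'` would; by `run_mono` that is at least as far as `q'` gets from the fictitious
position reached by repeating it `j` times. -/
theorem step (h : GreedyInv ph t j s) (hj : j < ph.length) (hph : (ph.map Prod.fst).Nodup) :
    GreedyInv ph t (j + 1) (greedyStep ph s) := by
  obtain ⟨l, hl, hc⟩ := h.covered
  rcases greedyStep_cases ph s with ⟨q, hq, h1, h2, h3, h4⟩ | ⟨h1, h2⟩
  · rw [h3]
    have hsuf := run_suffix q.2.2 s.1
    obtain ⟨pre, hpre⟩ := (List.tail_suffix (run q.2.2 s.1).1).trans hsuf
    refine ⟨⟨l ++ pre, ?_, fun x hx => ?_⟩, ?_, ?_, ?_, ?_⟩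
    · rw [List.append_assoc]; dsimp only; rw [hpre]; exact hl
    · rcases List.mem_append.1 hx with hx | hx
      · obtain ⟨q', hq', S, p, h5, h6⟩ := hc x hx
        exact ⟨q', hq', S, p, List.mem_cons_of_mem _ h5, h6⟩
      · exact ⟨q, hq, s.1, pre, List.mem_cons_self, hpre.symm, hx⟩
    · exact List.nodup_cons.2 ⟨h.assigned_eq_nil.1 h1, h.nodup⟩
    · intro e he
      rcases List.mem_cons.1 he with rfl | he
      · exact ⟨h2, ⟨l, hl.symm⟩⟩
      · exact h.valid e he
    · intro _ q' hq' hn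
      have hn' : q'.1 ∉ s.2.map Prod.fst := fun h5 => hn (List.mem_cons_of_mem _ h5)
      have h5 := h4 q' hq' (h.assigned_eq_nil.2 hn')
      have h6 := List.suffix_of_suffix_length_le hsuf (run_suffix q'.2.2 s.1) h5
      rw [Function.iterate_succ_apply']
      exact suffix_tail_of_suffix (h6.trans (run_mono _ (h.suffix h2 q' hq' hn')))
    · simpa using h.length_le
  · rw [h1]
    refine ⟨h.covered, h.nodup, h.valid, fun hne => ?_, h.length_le.trans (Nat.le_succ j)⟩
    -- If the tour is not exhausted, no phase is free; but at most `j < ph.length` of them have been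
    -- assigned.
    have h3 : (ph.map Prod.fst) ⊆ s.2.map Prod.fst := fun p hp => by
      obtain ⟨q, hq, rfl⟩ := List.mem_map.1 hp
      have := h2.resolve_left hne q hq
      rw [ne_eq, h.assigned_eq_nil, not_not] at this
      exact this
    have h4 := (List.subperm_of_subset hph h3).length_le
    have := h.length_le
    simp only [List.length_map] at h4
    omega

theorem iterate (hph : (ph.map Prod.fst).Nodup) (hj : j ≤ ph.length) :
    GreedyInv ph t j ((greedyStep ph)^[j] (t, [])) := by
  induction j with
  | zero =>
    exact ⟨⟨[], rfl, by simp⟩, by simp, by simp, fun _ _ _ _ => List.suffix_rfl, le_rfl⟩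
  | succ j ih =>
    rw [Function.iterate_succ_apply']
    exact (ih (by omega)).step (by omega) hph

end GreedyInv

theorem greedy_eq_iterate (ph : List Phase) (t : List ℕ) :
    greedy ph t = (greedyStep ph)^[ph.length] (t, []) := List.foldl_const _ _ _

theorem greedyStep_fst_eq_nil (ph : List Phase) {s : List ℕ × List (ℕ × List ℕ)} (h : s.1 = []) :
    (greedyStep ph s).1 = [] := by
  rcases greedyStep_cases ph s with ⟨-, -, -, h1, -⟩ | ⟨h1, -⟩
  · exact absurd h h1
  · rw [h1, h]

/-- The greedy algorithm distributes the whole tour if the sum of the potentials is small. -/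
theorem greedy_fst_eq_nil {ph : List Phase} {t : List ℕ} {D j : ℕ} (hph : (ph.map Prod.fst).Nodup)
    (hD : ∀ q ∈ ph, q.2.2.length = D) (hj : j ≤ ph.length)
    (h : (ph.map fun q => potential q.2.2 t).sum < (ph.length - j) * (j * D)) :
    (greedy ph t).1 = [] := by
  have hinv := GreedyInv.iterate (t := t) hph hj
  set s := (greedyStep ph)^[j] (t, []) with hs
  have hnil : s.1 = [] := by
    by_contra hne
    set f := ph.filter fun q => q.1 ∉ s.2.map Prod.fst with hf
    -- A phase still free would not exhaust the tour in `j` runs, and each run lowers its potential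
    -- by at least `D`.
    have h1 : ∀ x ∈ f.map fun q => potential q.2.2 t, j * D ≤ x := fun x hx => by
      obtain ⟨q, hq, rfl⟩ := List.mem_map.1 hx
      obtain ⟨hq, hq'⟩ := List.mem_filter.1 hq
      have h2 := hinv.suffix hne q hq (by simpa using hq')
      have h3 := mul_length_le_potential j (w := q.2.2) (S := t) fun h0 => by
        rw [h0] at h2; exact hne (List.suffix_nil.1 h2)
      rw [hD q hq] at h3; omega
    have h2 := List.card_nsmul_le_sum _ _ h1
    have h3 : (f.map fun q => potential q.2.2 t).sum ≤ (ph.map fun q => potential q.2.2 t).sum :=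
      (List.filter_sublist.map _).sum_le_sum fun _ _ => Nat.zero_le _
    -- At most one phase is used up per step.
    have h4 : ph.length ≤ f.length + j := by
      have h5 := List.length_eq_length_filter_add (l := ph)
        (fun q => decide (q.1 ∉ s.2.map Prod.fst))
      set g := ph.filter fun q => !decide (q.1 ∉ s.2.map Prod.fst) with hg
      have h6 : (g.map Prod.fst) ⊆ s.2.map Prod.fst := fun p hp => by
        obtain ⟨q, hq, rfl⟩ := List.mem_map.1 hp
        simpa using (List.mem_filter.1 hq).2
      have h7 : (g.map Prod.fst).length ≤ (s.2.map Prod.fst).length :=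
        (List.subperm_of_subset (hph.sublist (List.filter_sublist.map _)) h6).length_le
      have := hinv.length_le
      rw [List.length_map, List.length_map] at h7
      change ph.length = f.length + g.length at h5
      omega
    rw [List.length_map, smul_eq_mul] at h2
    have h5 := Nat.mul_le_mul_right (j * D) (by omega : ph.length - j ≤ f.length)
    omega
  have key : ∀ i, ((greedyStep ph)^[i] s).1 = [] := fun i => by
    induction i with
    | zero => exact hnil
    | succ i ih => rw [Function.iterate_succ_apply']; exact greedyStep_fst_eq_nil ph ih
  rw [greedy_eq_iterate, ← Nat.sub_add_cancel hj, Function.iterate_add_apply]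
  exact key _

/-! ## The tour along a minimum spanning tree -/

/-- Every number below `n` is joined to `S` by edges of `F`. -/
def Joins (F : Finset (Sym2 ℕ)) (n : ℕ) (S : Set ℕ) : Prop :=
  ∀ z < n, ∃ x ∈ S, Relation.ReflTransGen (fun a b => s(a, b) ∈ F) z x

/-- When `y` is added to `S`, an edge that leaves `S` can be removed. -/
theorem Joins.exchange {F : Finset (Sym2 ℕ)} {n y : ℕ} {S : Set ℕ} (h : Joins F n S) (hy : y < n)
    (hyS : y ∉ S) : ∃ a b, a ∈ S ∧ b ∉ S ∧ s(b, a) ∈ F ∧ Joins (F.erase s(b, a)) n (insert y S) := by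
  -- Follow the path from `z` to its first edge entering `S`; the part before that edge stays
  -- outside `S`.
  have key : ∀ x ∈ S, ∀ z, Relation.ReflTransGen (fun a b => s(a, b) ∈ F) z x → z ∉ S →
      ∃ a b, a ∈ S ∧ b ∉ S ∧ s(b, a) ∈ F ∧
        Relation.ReflTransGen (fun p q => s(p, q) ∈ F ∧ p ∉ S ∧ q ∉ S) z b := by
    intro x hx z hz
    induction hz using Relation.ReflTransGen.head_induction_on with
    | refl => exact fun h => absurd hx h
    | @head z c hzc _ ih =>
      intro hzS
      by_cases hc : c ∈ S
      · exact ⟨c, z, hc, hzS, hzc, .refl⟩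
      · obtain ⟨a, b, h1, h2, h3, h4⟩ := ih hc
        exact ⟨a, b, h1, h2, h3, .head ⟨hzc, hzS, hc⟩ h4⟩
  obtain ⟨x, hx, hyx⟩ := h y hy
  obtain ⟨a, b, ha, hb, hab, hyb⟩ := key x hx y hyx hyS
  -- The initial part avoids `S` and hence the edge to be removed; reversed, it links `b` to the new
  -- element `y`.
  have hby : Relation.ReflTransGen (fun p q => s(p, q) ∈ F.erase s(b, a)) b y := by
    have h1 : Relation.ReflTransGen (fun p q => s(p, q) ∈ F.erase s(b, a)) y b :=
      Relation.ReflTransGen.mono (fun p q h1 => Finset.mem_erase.2 ⟨fun h4 => by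
        rcases Sym2.eq_iff.1 h4 with ⟨-, rfl⟩ | ⟨rfl, -⟩
        · exact h1.2.2 ha
        · exact h1.2.1 ha, h1.1⟩) _ _ hyb
    have hs : Std.Symm fun p q => s(p, q) ∈ F.erase s(b, a) := ⟨fun p q h => by rwa [Sym2.eq_swap (a := q)]⟩
    exact Std.Symm.symm _ _ h1
  refine ⟨a, b, ha, hb, hab, fun z hz => ?_⟩
  obtain ⟨x, hx, hzx⟩ := h z hz
  clear hz
  induction hzx using Relation.ReflTransGen.head_induction_on with
  | refl => exact ⟨x, Set.mem_insert_of_mem _ hx, .refl⟩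
  | @head z c hzc _ ih =>
    obtain ⟨x', hx', hcx⟩ := ih
    -- A path that meets the removed edge is cut there: from `b` it is redirected to `y`, and at `a`
    -- it is already in `S`.
    by_cases he : s(z, c) = s(b, a)
    · rcases Sym2.eq_iff.1 he with ⟨rfl, -⟩ | ⟨rfl, -⟩
      · exact ⟨y, Set.mem_insert _ _, hby⟩
      · exact ⟨z, Set.mem_insert_of_mem _ ha, .refl⟩
    · exact ⟨x', hx', .head (Finset.mem_erase.2 ⟨he, hzc⟩) hcx⟩

theorem cost_append_cons (m : ℕ → ℕ → ℕ) (l l' : List ℕ) (x : ℕ) :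
    cost m (l ++ x :: l') = cost m (l ++ [x]) + cost m (x :: l') := by
  induction l with
  | nil => simp [cost]
  | cons y l ih =>
    cases l with
    | nil => simp [cost]
    | cons z l => simp only [List.cons_append, cost] at *; omega

theorem cost_extend {m : ℕ → ℕ → ℕ} (hm : ∀ x y, m x y = m y x) {t : List ℕ} {i : ℕ}
    (h : i < t.length) (y : ℕ) :
    cost m (t.take (i + 1) ++ y :: t.drop i) = cost m t + 2 * m t[i] y := by
  have h1 : t = t.take i ++ t[i] :: t.drop (i + 1) := by
    rw [← List.drop_eq_getElem_cons h, List.take_append_drop]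
  have h2 := cost_append_cons m (t.take i) (t.drop (i + 1)) t[i]
  rw [← h1] at h2
  rw [← List.take_append_getElem h, List.append_assoc, List.singleton_append, cost_append_cons,
    List.drop_eq_getElem_cons h]
  have := hm t[i] y
  simp only [cost]; omega

/-- What Prim's algorithm guarantees after `j` steps. -/
structure TourInv (n : ℕ) (m : ℕ → ℕ → ℕ) (W : Sym2 ℕ → ℕ) (F₀ : Finset (Sym2 ℕ)) (j : ℕ)
    (t : List ℕ) : Prop where
  ne_nil : t ≠ []
  lt : ∀ x ∈ t, x < n
  length : t.length + 1 = 2 * t.toFinset.card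
  complete : (∀ y < n, y ∈ t) ∨ j + 1 ≤ t.toFinset.card
  -- `F` is what is left of the comparison graph; every extension of the tour is paid for by one
  -- erased edge, counted twice for the way there and back.
  cost : ∃ F ⊆ F₀, Joins F n {x | x ∈ t} ∧ cost m t + 2 * ∑ e ∈ F, W e ≤ 2 * ∑ e ∈ F₀, W e

/-- The edge removed by `Joins.exchange` leads from the tour to a vertex off it. It was thus a
candidate for the extension and weighs at least as much as the edge chosen. -/
theorem TourInv.extend {n j : ℕ} {w : List Item} {W : Sym2 ℕ → ℕ} {F₀ : Finset (Sym2 ℕ)}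
    {t : List ℕ} (hW : ∀ x y, W s(x, y) = miss w x y)
    (hF₀ : ∀ a b, s(a, b) ∈ F₀ → a < n ∧ b < n) (h : TourInv n (miss w) W F₀ j t) :
    TourInv n (miss w) W F₀ (j + 1) (extendTour n w t) := by
  rcases extendTour_spec n w t with ⟨h1, h2⟩ | ⟨i, y, hi, hy, hyt, h1, h2⟩
  · rw [h1]
    refine ⟨h.ne_nil, h.lt, h.length, Or.inl fun y hy => ?_, h.cost⟩
    by_contra hyt
    have : ((0, y) : ℕ × ℕ) ∈ extensions n t :=
      mem_extensions.2 ⟨List.length_pos_iff.2 h.ne_nil, hy, hyt⟩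
    rw [h2] at this
    simp at this
  · rw [h1]
    have hti := List.getElem_mem hi
    have hmem : ∀ x, x ∈ t.take (i + 1) ++ y :: t.drop i ↔ x = y ∨ x ∈ t := fun x => by
      simp only [List.mem_append, List.mem_cons]
      constructor
      · rintro (h | h | h)
        · exact Or.inr (List.mem_of_mem_take h)
        · exact Or.inl h
        · exact Or.inr (List.mem_of_mem_drop h)
      · rintro (h | h)
        · exact Or.inr (Or.inl h)
        · rw [← List.take_append_drop i t, List.mem_append] at h
          rcases h with h | h
          · left
            rw [← List.take_append_getElem hi]
            exact List.mem_append_left _ h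
          · exact Or.inr (Or.inr h)
    have hcard : (t.take (i + 1) ++ y :: t.drop i).toFinset.card = t.toFinset.card + 1 := by
      rw [← Finset.card_insert_of_notMem (a := y) (by simpa using hyt)]
      congr 1
      ext x
      rw [List.mem_toFinset, hmem]
      simp
    obtain ⟨F, hF, hj, hc⟩ := h.cost
    refine ⟨by simp, fun x hx => ?_, ?_, ?_, ?_⟩
    · rcases (hmem x).1 hx with rfl | hx
      · exact hy
      · exact h.lt x hx
    · have := h.length
      rw [hcard]
      simp only [List.length_append, List.length_take, List.length_cons, List.length_drop]
      omega
    · rw [hcard]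
      rcases h.complete with h3 | h3
      · exact absurd (h3 y hy) hyt
      · exact Or.inr (by omega)
    · obtain ⟨a, b, ha, hb, hab, hj'⟩ := hj.exchange hy hyt
      refine ⟨F.erase s(b, a), (Finset.erase_subset _ _).trans hF, ?_, ?_⟩
      · convert hj' using 1
        ext x
        exact hmem x
      · obtain ⟨k, hk, hka⟩ := List.getElem_of_mem ha
        have h3 := h2 k b hk (hF₀ b a (hF hab)).1 hb
        rw [headD_drop 0 hi, headD_drop 0 hk, hka] at h3
        have h4 := Finset.add_sum_erase F W hab
        rw [Sym2.eq_swap, hW] at h4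
        rw [Sym2.eq_swap, cost_extend (fun x y => by rw [← hW, ← hW, Sym2.eq_swap]) hi]
        omega

/-- The tour visits all vertices, has at most `2 n - 1` vertices, and its cost is at most twice the
cost of any connected spanning graph. -/
theorem tourFrom_spec {n v : ℕ} (hv : v < n) {w : List Item} {W : Sym2 ℕ → ℕ}
    {F₀ : Finset (Sym2 ℕ)} (hW : ∀ x y, W s(x, y) = miss w x y)
    (hF₀ : ∀ a b, s(a, b) ∈ F₀ → a < n ∧ b < n)
    (hconn : ∀ z < n, Relation.ReflTransGen (fun a b => s(a, b) ∈ F₀) z v) :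
    (∀ x, x ∈ tourFrom n w v ↔ x < n) ∧ (tourFrom n w v).length + 1 ≤ 2 * n ∧
      cost (miss w) (tourFrom n w v) ≤ 2 * ∑ e ∈ F₀, W e := by
  have hinv : ∀ j, TourInv n (miss w) W F₀ j ((extendTour n w)^[j] [v]) := fun j => by
    induction j with
    | zero =>
      refine ⟨by simp, by simpa using hv, by simp, by simp, F₀, subset_rfl,
        fun z hz => ⟨v, by simp, hconn z hz⟩, by simp [cost]⟩
    | succ j ih => rw [Function.iterate_succ_apply']; exact ih.extend hW hF₀
  have h : TourInv n (miss w) W F₀ n (tourFrom n w v) := by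
    have h1 : tourFrom n w v = (extendTour n w)^[(List.replicate n ()).length] [v] :=
      List.foldl_const _ _ _
    rw [h1, List.length_replicate]
    exact hinv n
  have hcard : (tourFrom n w v).toFinset.card ≤ n := by
    have : (tourFrom n w v).toFinset ⊆ Finset.range n := fun x hx =>
      Finset.mem_range.2 (h.lt x (List.mem_toFinset.1 hx))
    simpa using Finset.card_le_card this
  refine ⟨fun x => ⟨h.lt x, fun hx => ?_⟩, ?_, ?_⟩
  · rcases h.complete with h1 | h1
    · exact h1 x hx
    · omega
  · have := h.length; omega
  · obtain ⟨F, -, -, h1⟩ := h.cost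
    omega

/-! ## The planned walk visits all vertices -/

theorem length_of_mem_phases {I : List Item} {D : ℕ} {q : Phase} (h : q ∈ phases I D) :
    q.2.2.length = D := by
  obtain ⟨p, hp, rfl⟩ := mem_phases h
  have : (p + 1) * (D + D) = p * (D + D) + D + D := by ring
  simp only [phaseAt, List.length_take, List.length_drop]
  omega

theorem nodup_phases (I : List Item) (D : ℕ) : ((phases I D).map Prod.fst).Nodup := by
  rw [phases_eq, List.map_map]
  have : Prod.fst ∘ phaseAt I D = id := rfl
  rw [this, List.map_id]
  exact (pairwise_phase_numbers I D).imp fun h => h.ne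

theorem le_length_phases {I : List Item} {D r : ℕ} (hD : 1 ≤ D) (h : r * (D + D) ≤ I.length) :
    r ≤ (phases I D).length := by
  rw [phases_eq, List.length_map]
  have hsub : List.range r ⊆ (List.range (I.length + 1)).filter fun p =>
      Nat.ble ((p + 1) * (D + D)) I.length := fun p hp => by
    have hp := List.mem_range.1 hp
    have h1 : (p + 1) * (D + D) ≤ I.length := (Nat.mul_le_mul_right _ hp).trans h
    have h2 : p + 1 ≤ (p + 1) * (D + D) := Nat.le_mul_of_pos_right _ (by omega)
    refine List.mem_filter.2 ⟨List.mem_range.2 (by omega), ?_⟩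
    rwa [Nat.ble_eq]
  simpa using (List.subperm_of_subset List.nodup_range hsub).length_le

/-- Misses add up over the phases. This is why one tour, optimised for all second intervals
together, controls the potentials on average. -/
theorem sum_potential (ph : List Phase) (t : List ℕ) :
    (ph.map fun q => potential q.2.2 t).sum =
      ph.length * t.length + cost (miss (ph.flatMap fun q => q.2.2)) t := by
  induction ph with
  | nil =>
    have h : ∀ l, cost (miss []) l = 0 := fun l => by
      induction l with
      | nil => rfl
      | cons x l ih =>
        cases l with
        | nil => rfl
        | cons y l => simp only [cost, ih]; rfl
    simp [h]
  | cons q ph ih =>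
    have h : cost (miss ((q :: ph).flatMap fun q => q.2.2)) t =
        cost (miss q.2.2) t + cost (miss (ph.flatMap fun q => q.2.2)) t := by
      rw [← cost_add]; congr 1; funext x y; rw [List.flatMap_cons, miss_append]
    rw [List.map_cons, List.sum_cons, ih, h, potential, List.length_cons, Nat.add_mul]
    omega

theorem length_flatMap_phases (I : List Item) (D : ℕ) :
    ((phases I D).flatMap fun q => q.2.2).length = (phases I D).length * D := by
  rw [List.length_flatMap, List.sum_eq_card_nsmul _ D, List.length_map, smul_eq_mul]
  intro x hx
  obtain ⟨q, hq, rfl⟩ := List.mem_map.1 hx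
  exact length_of_mem_phases hq

section Weights

variable {n L : ℕ} {G : TemporalGraph (Fin n) L}

open Classical in
/-- The number of snapshots that do not contain an edge. -/
noncomputable def weight (w : List Item) (e : Sym2 ℕ) : ℕ :=
  w.countP fun it => decide (∀ x y, e = s(x, y) → adj it.2 x y = false)

theorem adj_comm_of_mem_timed {it : Item} (h : it ∈ timed (mats G)) (x y : ℕ) :
    adj it.2 x y = adj it.2 y x := by
  rw [Bool.eq_iff_iff, adj_of_mem_timed G h, adj_of_mem_timed G h]
  exact ⟨AdjAt.symm, AdjAt.symm⟩

-- The weight is defined on unordered pairs by quantifying over both orders; by symmetry of the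
-- snapshots either order decides.
open Classical in
theorem weight_mk {w : List Item} (hw : ∀ it ∈ w, it ∈ timed (mats G)) (x y : ℕ) :
    weight w s(x, y) = miss w x y := by
  rw [weight, miss, List.countP_eq_length_filter]
  congr 1
  refine List.filter_congr fun it hit => ?_
  rw [Bool.eq_iff_iff, decide_eq_true_iff]
  constructor
  · intro h; simp [h x y rfl]
  · intro h x' y' he
    rcases Sym2.eq_iff.1 he with ⟨rfl, rfl⟩ | ⟨rfl, rfl⟩
    · simpa using h
    · rw [adj_comm_of_mem_timed (hw it hit)]; simpa using h

-- Double counting: every snapshot misses at most `k` edges of `T`, so it contributes at most `k` to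
-- the total weight.
open Classical in
theorem sum_weight_le {k : ℕ} {T : SimpleGraph (Fin n)}
    (hT : ∀ t, TemporalGraph.SnapshotDeficient k T (G t)) {w : List Item}
    (hw : ∀ it ∈ w, it ∈ timed (mats G)) :
    ∑ e ∈ T.edgeFinset.image (Sym2.map Fin.val), weight w e ≤ k * w.length := by
  induction w with
  | nil => simp [weight]
  | cons it w ih =>
    have h1 := ih fun it hit => hw it (List.mem_cons_of_mem _ hit)
    have h2 : ∀ e, weight (it :: w) e = weight w e +
        if (∀ x y, e = s(x, y) → adj it.2 x y = false) then 1 else 0 := fun e => by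
      simp only [weight, List.countP_cons, decide_eq_true_eq]
    rw [Finset.sum_congr rfl fun e _ => h2 e, Finset.sum_add_distrib, List.length_cons, Nat.mul_add,
      mul_one, ← Finset.card_filter]
    refine Nat.add_le_add h1 ?_
    have hit := hw it List.mem_cons_self
    obtain ⟨t, ht, hti⟩ := List.getElem_of_mem hit
    have ht' : t < L := by rwa [length_timed] at ht
    have h3 : (((T.edgeFinset.image (Sym2.map Fin.val)).filter fun e =>
        ∀ x y, e = s(x, y) → adj it.2 x y = false : Finset (Sym2 ℕ)) : Set (Sym2 ℕ)) ⊆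
        Sym2.map Fin.val '' (T.edgeSet \ (G ⟨t, ht'⟩).edgeSet) := by
      intro e he
      obtain ⟨he, hadj⟩ := Finset.mem_filter.1 (Finset.mem_coe.1 he)
      obtain ⟨e, heT, rfl⟩ := Finset.mem_image.1 he
      refine ⟨e, ⟨SimpleGraph.mem_edgeFinset.1 heT, fun heG => ?_⟩, rfl⟩
      induction e with
      | _ x y =>
        have h4 := hadj x y (Sym2.map_mk _ _ _)
        rw [← Bool.not_eq_true, ← hti, adj_getElem_timed] at h4
        exact h4 ⟨ht', x.2, y.2, heG⟩
    have h4 := (Set.encard_le_encard h3).trans ((Set.encard_image_le _ _).trans (hT ⟨t, ht'⟩))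
    rw [Set.encard_coe_eq_coe_finsetCard] at h4
    exact_mod_cast h4

open Classical in
/-- If `D` is large enough, but small compared to `L`, then the planned walk visits all vertices. -/
theorem visitsAll_plan {Δ k D v : ℕ} (hG : G.DeltaTemporallyConnected Δ) (hk : G.EdgeDeficient k)
    (hD : Δ ≤ D) (hD1 : 1 ≤ D) (hn : n ≤ 2 * k * D) (hL : (24 * k + 2) * (D + D) ≤ L)
    (hv : v < n) : visitsAll n v (plan n v (phases (timed (mats G)) D)) = true := by
  obtain ⟨T, ⟨-, hT⟩, hdef⟩ := hk
  set ph := phases (timed (mats G)) D with hph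
  set U := ph.flatMap fun q => q.2.2 with hU
  have hUmem : ∀ it ∈ U, it ∈ timed (mats G) := fun it hit => by
    obtain ⟨q, hq, hit⟩ := List.mem_flatMap.1 hit
    obtain ⟨p, -, rfl⟩ := mem_phases hq
    exact List.mem_of_mem_drop (List.mem_of_mem_take hit)
  have hF₀ : ∀ a b, s(a, b) ∈ T.edgeFinset.image (Sym2.map Fin.val) → a < n ∧ b < n := by
    intro a b h
    obtain ⟨e, -, he⟩ := Finset.mem_image.1 h
    induction e with
    | _ x y =>
      rcases Sym2.eq_iff.1 ((Sym2.map_mk _ _ _).symm.trans he) with ⟨rfl, rfl⟩ | ⟨rfl, rfl⟩ <;>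
        exact ⟨Fin.is_lt _, Fin.is_lt _⟩
  have hconn : ∀ z < n, Relation.ReflTransGen
      (fun a b => s(a, b) ∈ T.edgeFinset.image (Sym2.map Fin.val)) z v := by
    intro z hz
    have h1 := (SimpleGraph.reachable_iff_reflTransGen _ _).1
      (hT.connected.preconnected ⟨z, hz⟩ ⟨v, hv⟩)
    exact Relation.ReflTransGen.lift (fun x : Fin n => (x : ℕ)) (fun x y h =>
      Finset.mem_image.2 ⟨s(x, y), SimpleGraph.mem_edgeFinset.2 h, Sym2.map_mk _ _ _⟩) _ _ h1
  obtain ⟨h1, h2, h3⟩ := tourFrom_spec hv (weight_mk hUmem) hF₀ hconn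
  set t := tourFrom n U v with ht
  have h4 := sum_weight_le hdef hUmem
  have h5 : U.length = ph.length * D := length_flatMap_phases _ _
  have h6 : 24 * k + 2 ≤ ph.length := le_length_phases hD1 (by rwa [length_timed])
  have h7 : (greedy ph t).1 = [] := by
    refine greedy_fst_eq_nil (D := D) (j := ph.length / 2) (nodup_phases _ _)
      (fun q hq => length_of_mem_phases hq) (by omega) ?_
    rw [sum_potential]
    have h8 : cost (miss U) t ≤ 2 * (k * (ph.length * D)) := by
      rw [← h5]; omega
    -- The tour has at most `2 * n - 1` vertices and `n ≤ 2 * k * D`; the saved `1` makes the final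
    -- inequality strict.
    have h9 : ph.length * t.length + ph.length ≤ ph.length * (4 * k * D) := by
      have := Nat.mul_le_mul_left ph.length (by nlinarith : t.length + 1 ≤ 4 * k * D)
      rwa [Nat.mul_add, mul_one] at this
    -- The larger half of the phases is at least `ph.length / 2` as a real number, the smaller at
    -- least `12 * k`. The factor `6 * k` is `4 * k` for the vertices of the tour plus `2 * k` for
    -- the misses.
    have h10 : 6 * k * ph.length ≤ (ph.length - ph.length / 2) * (ph.length / 2) := by
      have := Nat.mul_le_mul (by omega : ph.length ≤ 2 * (ph.length - ph.length / 2))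
        (by omega : 12 * k ≤ ph.length / 2)
      nlinarith
    have h11 := Nat.mul_le_mul_right D h10
    rw [Nat.mul_assoc (ph.length - ph.length / 2)] at h11
    change _ + cost (miss U) t < _
    nlinarith
  have hinv : GreedyInv ph t ph.length (greedy ph t) := by
    rw [greedy_eq_iterate]
    exact GreedyInv.iterate (nodup_phases _ _) le_rfl
  refine List.all_eq_true.2 fun y hy => ?_
  obtain ⟨l, hl, hcov⟩ := hinv.covered
  rw [h7, List.append_nil] at hl
  obtain ⟨q, hq, S, pre, hS, hpre, hy'⟩ := hcov y (hl ▸ (h1 y).2 (List.mem_range.1 hy))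
  have hS' := hinv.assigned_eq hS
  obtain ⟨hne, hsuf⟩ := hinv.valid _ hS
  have hlt : S.headD 0 < n := by
    refine (h1 _).1 (hsuf.mem ?_)
    cases S with
    | nil => exact absurd rfl hne
    | cons a S => exact List.mem_cons_self
  subst hS'
  have := travel_visits hG hD hv hq hne hlt hpre hy'
  rw [List.contains_iff_mem, plan, List.map_reverse, List.mem_cons, List.mem_reverse]
  exact List.mem_cons.1 this

end Weights

/-! ## The theorem -/

theorem exists_visitsAll {n L Δ k v : ℕ} {G : TemporalGraph (Fin n) L} (h : G.LongStable Δ k)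
    (hv : v < n) : ∃ D ≤ L, visitsAll n v (plan n v (phases (timed (mats G)) D)) = true := by
  obtain ⟨hk, hG, hdef, hL⟩ := h
  -- With at most one vertex any `D` will do; this case is separate because it allows `Δ = 0`.
  rcases Nat.lt_or_ge n 2 with hn | hn
  · refine ⟨0, Nat.zero_le _, List.all_eq_true.2 fun y hy => ?_⟩
    have := List.mem_range.1 hy
    have hyv : y = v := by omega
    simp [hyv]
  have hΔ : 1 ≤ Δ := by
    by_contra h0
    obtain rfl : Δ = 0 := by omega
    obtain ⟨w, -, hw⟩ := hG 0 (Nat.zero_le _) ⟨0, by omega⟩ ⟨1, by omega⟩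
    cases w with
    | nil => simp [TemporalGraph.walkEnd] at hw
    | cons m w => exact m.1.elim0
  have hk' : (1 : ℝ) ≤ k := by exact_mod_cast hk
  have hpos : (0 : ℝ) < 2 * k := by linarith
  -- The logarithm enters only through `log (12 * k) ≥ 1`, and `36 * k ≥ 24 * k + 2`.
  have hR : 24 * (k : ℝ) + 2 ≤ ⌈36 * (k : ℝ) * Real.log (12 * (k : ℝ))⌉₊ := by
    refine le_trans ?_ (Nat.le_ceil _)
    have hlog : 1 ≤ Real.log (12 * (k : ℝ)) := by
      rw [Real.le_log_iff_exp_le (by linarith)]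
      have := Real.exp_one_lt_d9
      linarith
    nlinarith
  set D := max Δ ⌈(n : ℝ) / (2 * k)⌉₊ with hD
  -- Rounding up costs less than `1 ≤ Δ`.
  have hDle : (D : ℝ) ≤ Δ + n / (2 * k) := by
    have h0 : (0 : ℝ) ≤ n / (2 * k) := by positivity
    have h1 := Nat.ceil_lt_add_one h0
    have h2 : (1 : ℝ) ≤ Δ := by exact_mod_cast hΔ
    rw [hD, Nat.cast_max]
    exact max_le (by linarith) (by linarith)
  have hnD : n ≤ 2 * k * D := by
    have h1 : (n : ℝ) / (2 * k) ≤ D :=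
      (Nat.le_ceil _).trans (Nat.cast_le.2 (le_max_right _ _))
    rw [div_le_iff₀ hpos] at h1
    have h2 : (n : ℝ) ≤ 2 * k * D := by linarith
    exact_mod_cast h2
  have hLD : (24 * k + 2) * (D + D) ≤ L := by
    rw [Fintype.card_fin] at hL
    have h0 : (0 : ℝ) ≤ D := Nat.cast_nonneg _
    have h1 : (24 * (k : ℝ) + 2) * D ≤
        ⌈36 * (k : ℝ) * Real.log (12 * (k : ℝ))⌉₊ * (Δ + n / (2 * k)) :=
      mul_le_mul hR hDle h0 (by linarith)
    have h2 : (24 * (k : ℝ) + 2) * (D + D) ≤ L := by linarith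
    exact_mod_cast h2
  have hDL : D ≤ L := by nlinarith
  exact ⟨D, hDL, visitsAll_plan hG hdef (le_max_left _ _) (hΔ.trans (le_max_left _ _)) hnD hLD hv⟩

theorem isScheduleCode_solve_of_longStable {n L Δ k : ℕ} {G : TemporalGraph (Fin n) L}
    (h : G.LongStable Δ k) (v : Fin n) :
    IsScheduleCode G v (enc (solve (n, (v : ℕ), mats G))) := by
  obtain ⟨D, hD, hvis⟩ := exists_visitsAll h v.2
  exact isScheduleCode_solve hD hvis

/-! ### Isomorphic temporal graphs -/

section Transport

variable {V W : Type*} {L : ℕ}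

theorem isWalk_map {G : TemporalGraph V L} {H : TemporalGraph W L} {f : V → W}
    (hf : ∀ t x y, (G t).Adj x y → (H t).Adj (f x) (f y)) {w : List (Fin L × V)} {v : V}
    (h : G.IsWalk v w) : H.IsWalk (f v) (w.map fun m => (m.1, f m.2)) ∧
      TemporalGraph.walkEnd (f v) (w.map fun m => (m.1, f m.2)) =
        f (TemporalGraph.walkEnd v w) := by
  induction w generalizing v with
  | nil => exact ⟨trivial, rfl⟩
  | cons m w ih =>
    obtain ⟨t, u⟩ := m
    obtain ⟨h1, h2, h3⟩ := h
    obtain ⟨h4, h5⟩ := ih h3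
    refine ⟨⟨hf t _ _ h1, fun m hm => ?_, h4⟩, h5⟩
    obtain ⟨m', hm', rfl⟩ := List.mem_map.1 hm
    exact h2 m' hm'

/-- The temporal graph with renamed vertices. -/
def relabel (G : TemporalGraph V L) (e : V ≃ W) : TemporalGraph W L := fun t => (G t).comap e.symm

theorem longStable_relabel [Fintype V] [Fintype W] {G : TemporalGraph V L} {Δ k : ℕ}
    (h : G.LongStable Δ k) (e : V ≃ W) : (relabel G e).LongStable Δ k := by
  obtain ⟨hk, hG, ⟨T, ⟨hTG, hT⟩, hdef⟩, hL⟩ := h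
  refine ⟨hk, fun s hs x y => ?_, ⟨T.comap e.symm, ⟨fun x y hxy => hTG hxy, ?_⟩, fun t => ?_⟩, ?_⟩
  · obtain ⟨w, hw, hw'⟩ := hG s hs (e.symm x) (e.symm y)
    obtain ⟨h1, h2⟩ := isWalk_map (H := (relabel G e).window s Δ hs) (f := e)
      (fun t a b hab => by simpa [relabel, TemporalGraph.window] using hab) hw
    rw [hw'] at h2
    simp only [Equiv.apply_symm_apply] at h1 h2
    exact ⟨_, h1, h2⟩
  · exact (SimpleGraph.Iso.comap e.symm T).isTree_iff.2 hT
  · refine (Set.encard_le_encard ?_).trans ((Set.encard_image_le (Sym2.map e) _).trans (hdef t))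
    intro z hz
    induction z with
    | _ x y =>
      refine ⟨s(e.symm x, e.symm y), hz, ?_⟩
      simp
  · rwa [← Fintype.card_congr e]

theorem length_le_of_isWalk {G : TemporalGraph V L} {v : V} {w : List (Fin L × V)}
    (h : G.IsWalk v w) : w.length ≤ L := by
  have key : ∀ (w : List (Fin L × V)) v, G.IsWalk v w → (w.map Prod.fst).Pairwise (· < ·) := by
    intro w
    induction w with
    | nil => intro v _; simp
    | cons m w ih =>
      intro v h
      obtain ⟨t, u⟩ := m
      obtain ⟨-, h2, h3⟩ := h
      refine List.pairwise_cons.2 ⟨fun s hs => ?_, ih u h3⟩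
      obtain ⟨m, hm, rfl⟩ := List.mem_map.1 hs
      exact h2 m hm
  have h1 : (w.map Prod.fst).Nodup := (key w v h).imp fun h => h.ne
  simpa using h1.length_le_card

/-- The algorithm works on `Fin n`; its walk is carried over along a bijection. The length bound is
automatic, since the time steps strictly increase. -/
theorem explorableFrom_of_longStable [Fintype V] {G : TemporalGraph V L} {Δ k : ℕ}
    (h : G.LongStable Δ k) (v : V) : G.ExplorableFrom v := by
  let e := Fintype.equivFin V
  obtain ⟨w, -, hw, hvis⟩ := isScheduleCode_solve_of_longStable (longStable_relabel h e) (e v)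
  obtain ⟨h1, -⟩ := isWalk_map (H := G) (f := e.symm) (fun t a b hab => hab) hw
  rw [Equiv.symm_apply_apply] at h1
  refine ⟨_, length_le_of_isWalk h1, h1, fun u => ?_⟩
  have h2 := hvis (e u)
  simp only [List.mem_cons, EmbeddingLike.apply_eq_iff_eq, List.mem_map] at h2 ⊢
  rcases h2 with h2 | ⟨m, hm, h2⟩
  · exact Or.inl h2
  · exact Or.inr ⟨_, ⟨m, hm, rfl⟩, by simp [h2]⟩

end Transport

/-! ### The size of the input -/

theorem sz_input_le {n L : ℕ} (G : TemporalGraph (Fin n) L) (v : Fin n) :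
    sz (n, (v : ℕ), mats G) ≤ (n + L) * ((n + L) * ((n + L) * 4 + 2) + 2) + 4 * (n + L) + 5 := by
  have h1 : ∀ f : Fin n → Bool, sz (List.ofFn f) ≤ n * 4 + 1 := fun f => by
      simpa using sz_list_le (l := List.ofFn f) (c := 3) fun b _ => sz_bool_le b
  have h2 : sz (mats G) ≤ L * (n * (n * 4 + 2) + 2) + 1 := by
    unfold mats
    refine (sz_list_le (c := n * (n * 4 + 2) + 1) fun M hM => ?_).trans (by simp)
    obtain ⟨t, rfl⟩ := List.mem_ofFn.1 hM
    refine (sz_list_le (c := n * 4 + 1) fun r hr => ?_).trans (by simp)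
    obtain ⟨x, rfl⟩ := List.mem_ofFn.1 hr
    exact h1 _
  have h3 : L * (n * (n * 4 + 2) + 2) ≤ (n + L) * ((n + L) * ((n + L) * 4 + 2) + 2) := by
    gcongr <;> omega
  have h4 := v.2
  simp only [sz_pair, sz_nat] at *
  omega

/-- A deterministic program, running in polynomial time, that computes exploration schedules. -/
theorem exists_prog : ∃ (P : Prog) (p : Polynomial ℕ), P.Deterministic ∧
    ∀ (n L Δ k : ℕ) (G : TemporalGraph (Fin n) L), G.LongStable Δ k → ∀ (v : Fin n) (ω : Coins),
      ∃ (b : BTree) (m : ℕ), P.Outputs (encodeInput G v) ω b m ∧ m ≤ p.eval (n + L) ∧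
        IsScheduleCode G v b := by
  obtain ⟨-, P, N, q, hP, -, h⟩ := PT.solve
  refine ⟨P, q.comp (Polynomial.X * (Polynomial.X * (Polynomial.X * 4 + 2) + 2) +
    4 * Polynomial.X + 5), hP, fun n L Δ k G hG v ω => ?_⟩
  obtain ⟨σ, m, h1, h2, -, h3⟩ := h (n, (v : ℕ), mats G)
    (Function.update (fun _ => BTree.nil) 0 (encodeInput G v))
    (by rw [Function.update_self, encodeInput_eq])
  refine ⟨_, m, ⟨(σ, ω), h1 ω, rfl⟩, h3.trans ?_, ?_⟩
  · rw [Polynomial.eval_comp]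
    apply polynomial_eval_mono
    refine (sz_input_le G v).trans (le_of_eq ?_)
    simp
  · change IsScheduleCode G v (σ 0)
    rw [h2]
    exact isScheduleCode_solve_of_longStable hG v

theorem expectedTime_le {P : Prog} {a : BTree} {c : ℕ}
    (h : ∀ ω, ∃ b m, P.Outputs a ω b m ∧ m ≤ c) : P.expectedTime a ≤ c := by
  have h1 : ∀ ω, P.runTime a ω ≤ c := fun ω => by
    obtain ⟨b, m, hb, hm⟩ := h ω
    exact (iInf₂_le m ⟨b, hb⟩).trans (by exact_mod_cast hm)
  have hprob : IsProbabilityMeasure coinMeasure := by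
    unfold coinMeasure; infer_instance
  calc P.expectedTime a ≤ ∫⁻ _, (c : ℝ≥0∞) ∂coinMeasure := lintegral_mono h1
    _ = c := by simp

theorem Prog.Outputs.unique {P : Prog} {a b b' : BTree} {ω : Coins} {m m' : ℕ}
    (h : P.Outputs a ω b m) (h' : P.Outputs a ω b' m') : b = b' := by
  obtain ⟨s, h1, rfl⟩ := h
  obtain ⟨s', h2, rfl⟩ := h'
  rw [(h1.unique h2).1]

end TemporalExploration

/-- Existence of exploration schedules, a Las Vegas algorithm with expected polynomial running
time, and a deterministic algorithm that is polynomial for every fixed `k`. The algorithms receive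
only the temporal graph (on the vertices `0, …, n - 1`) and the start vertex; the size of the
instance is measured by `n + L`, which is at most the length of its encoding. -/
theorem theorem2 :
    (∀ (V : Type*) [Fintype V] (L Δ k : ℕ) (G : TemporalGraph V L),
      G.LongStable Δ k → ∀ v : V, G.ExplorableFrom v) ∧
    (∃ (P : Prog) (p : Polynomial ℕ),
      ∀ (n L Δ k : ℕ) (G : TemporalGraph (Fin n) L), G.LongStable Δ k → ∀ v : Fin n,
        (∀ (ω : Coins) (b : BTree) (m : ℕ),
          P.Outputs (encodeInput G v) ω b m → IsScheduleCode G v b) ∧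
        P.expectedTime (encodeInput G v) ≤ (p.eval (n + L) : ℕ)) ∧
    (∃ P : Prog, P.Deterministic ∧ ∀ k : ℕ, ∃ p : Polynomial ℕ,
      ∀ (n L Δ : ℕ) (G : TemporalGraph (Fin n) L), G.LongStable Δ k → ∀ v : Fin n,
        ∀ ω : Coins, ∃ (b : BTree) (m : ℕ),
          P.Outputs (encodeInput G v) ω b m ∧ m ≤ p.eval (n + L) ∧ IsScheduleCode G v b) := by
  obtain ⟨P, p, hP, h⟩ := exists_prog
  -- The same program serves both algorithmic claims: it ignores the coins, and its polynomial
  -- depends on neither `k` nor `Δ`.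
  refine ⟨fun V _ L Δ k G hG v => explorableFrom_of_longStable hG v, ⟨P, p, fun n L Δ k G hG v =>
    ⟨fun ω b m hb => ?_, expectedTime_le fun ω => ?_⟩⟩,
    ⟨P, hP, fun k => ⟨p, fun n L Δ G hG v ω => h n L Δ k G hG v ω⟩⟩⟩
  · obtain ⟨b', m', h1, -, h2⟩ := h n L Δ k G hG v ω
    rwa [hb.unique h1]
  · obtain ⟨b, m, h1, h2, -⟩ := h n L Δ k G hG v ω
    exact ⟨b, m, h1, h2⟩
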